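/- A DL-Lite$_{\text{core}}$ ontology $\mathcal{O}$ consists of finitely many inclusions $B_1\sqsubseteq B_2$ and $B_1\sqsubseteq\neg B_2$, where each basic concept $B_i$ is a concept name $A$ or has the form $\exists R$ with $R$ a role name $P$ or its inverse $P^{-}$, and of finitely many assertions $A(a)$, $P(a,b)$ about constants $a,b$. A Boolean conjunctive query with inequalities $\psi$ is the existential closure of a finite conjunction of atoms $A(x)$, $P(x,y)$ and inequalities $x\neq y$, with $x,y$ variables. Under the Unique Name Assumption, a model of $\mathcal{O}$ is a (nonempty, finite or infinite) relational structure in which all inclusions and assertions of $\mathcal{O}$ are true and different constants mentioned in $\mathcal{O}$ are interpreted as different elements; $\mathcal{O}\models\psi$ means that $\psi$ is true in every model of $\mathcal{O}$. Theorem. Under the Unique Name Assumption, the following problem is undecidable: given a DL-Lite$_{\text{core}}$ ontology $\mathcal{O}$ and a Boolean conjunctive query with inequalities $\psi$, does $\mathcal{O}\models\psi$ hold? -/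

import Mathlib

universe u

namespace DLLite

/-! Concept names, role names, individual constants and query variables are natural numbers, in four
separate name spaces (they are told apart by their position in the syntax). -/

/-- Roles of DL-Lite_core: a role name `P` or its inverse `P⁻`. -/
inductive Role where
  | name (P : ℕ)
  | inv (P : ℕ)

/-- Basic concepts of DL-Lite_core: a concept name `A` or an unqualified existential `∃R`. -/
inductive BasicConcept where
  | name (A : ℕ)
  | exist (R : Role)

/-- TBox statements of DL-Lite_core: `B₁ ⊑ B₂` and `B₁ ⊑ ¬B₂` for basic concepts `B₁`, `B₂`. -/
inductive Inclusion where
  | sub (B₁ B₂ : BasicConcept)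
  | disj (B₁ B₂ : BasicConcept)

/-- ABox statements of DL-Lite_core: `A(a)` and `P(a, b)` for constants `a`, `b`. -/
inductive Assertion where
  | concept (A : ℕ) (a : ℕ)
  | role (P : ℕ) (a b : ℕ)

/-- A DL-Lite_core ontology: finitely many inclusions and finitely many ground assertions. -/
structure Ontology where
  tbox : List Inclusion
  abox : List Assertion

/-- Conjuncts of a conjunctive query with inequalities; `x`, `y` are variables. -/
inductive Atom where
  | concept (A : ℕ) (x : ℕ)
  | role (P : ℕ) (x y : ℕ)
  | ne (x y : ℕ)

/-- A Boolean conjunctive query with inequalities: the existential closure of the conjunction of a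
finite list of relational atoms and inequalities. -/
structure BCQ where
  atoms : List Atom

/-! ### Semantics -/

/-- A relational structure, together with an interpretation of the constants. -/
structure Interp where
  /-- the set of vertices (it is nonempty, as constants are interpreted in it) -/
  Dom : Type u
  const : ℕ → Dom
  concept : ℕ → Dom → Prop
  role : ℕ → Dom → Dom → Prop

/-- `R.Holds I s t`: the pair `(s, t)` belongs to the role `R` in `I`. -/
def Role.Holds (I : Interp.{u}) : Role → I.Dom → I.Dom → Prop
  | .name P, s, t => I.role P s t
  | .inv P, s, t => I.role P t s

/-- `B.Holds I s`: the vertex `s` belongs to the basic concept `B` in `I`. -/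
def BasicConcept.Holds (I : Interp.{u}) : BasicConcept → I.Dom → Prop
  | .name A, s => I.concept A s
  | .exist R, s => ∃ t, R.Holds I s t

def Inclusion.Holds (I : Interp.{u}) : Inclusion → Prop
  | .sub B₁ B₂ => ∀ s, B₁.Holds I s → B₂.Holds I s
  | .disj B₁ B₂ => ∀ s, B₁.Holds I s → ¬ B₂.Holds I s

def Assertion.Holds (I : Interp.{u}) : Assertion → Prop
  | .concept A a => I.concept A (I.const a)
  | .role P a b => I.role P (I.const a) (I.const b)

/-- The constants mentioned in an assertion. -/
def Assertion.constants : Assertion → Set ℕ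
  | .concept _ a => {a}
  | .role _ a b => {a, b}

/-- The constants mentioned in an ontology. -/
def Ontology.constants (O : Ontology) : Set ℕ :=
  {c | ∃ α ∈ O.abox, c ∈ α.constants}

/-- `I` is a model of `O` under the Unique Name Assumption: all statements of `O` are true in `I`,
and different constants mentioned in `O` are interpreted as different vertices. -/
structure Ontology.IsModel (O : Ontology) (I : Interp.{u}) : Prop where
  tbox : ∀ τ ∈ O.tbox, τ.Holds I
  abox : ∀ α ∈ O.abox, α.Holds I
  uniqueNames : Set.InjOn I.const O.constants

/-- Truth of a conjunct under an assignment of vertices to the variables. -/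
def Atom.Holds (I : Interp.{u}) (v : ℕ → I.Dom) : Atom → Prop
  | .concept A x => I.concept A (v x)
  | .role P x y => I.role P (v x) (v y)
  | .ne x y => v x ≠ v y

/-- Truth of a Boolean query in a structure. -/
def BCQ.Holds (ψ : BCQ) (I : Interp.{u}) : Prop :=
  ∃ v : ℕ → I.Dom, ∀ α ∈ ψ.atoms, α.Holds I v

/-- `O ⊨ ψ` under the Unique Name Assumption: `ψ` is true in every model of `O`. -/
def Ontology.Entails (O : Ontology) (ψ : BCQ) : Prop :=
  ∀ I : Interp.{u}, O.IsModel I → ψ.Holds I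

/-! ### Encoding of ontologies and queries as inputs of algorithms

Every syntactic object is coded through the evident sums, products and lists of natural numbers. -/

def Role.equiv : Role ≃ ℕ ⊕ ℕ where
  toFun
    | .name P => .inl P
    | .inv P => .inr P
  invFun
    | .inl P => .name P
    | .inr P => .inv P
  left_inv := by rintro (_ | _) <;> rfl
  right_inv := by rintro (_ | _) <;> rfl

instance : Primcodable Role := Primcodable.ofEquiv _ Role.equiv

def BasicConcept.equiv : BasicConcept ≃ ℕ ⊕ Role where
  toFun
    | .name A => .inl A
    | .exist R => .inr R
  invFun
    | .inl A => .name A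
    | .inr R => .exist R
  left_inv := by rintro (_ | _) <;> rfl
  right_inv := by rintro (_ | _) <;> rfl

instance : Primcodable BasicConcept := Primcodable.ofEquiv _ BasicConcept.equiv

def Inclusion.equiv : Inclusion ≃ (BasicConcept × BasicConcept) ⊕ (BasicConcept × BasicConcept) where
  toFun
    | .sub B₁ B₂ => .inl (B₁, B₂)
    | .disj B₁ B₂ => .inr (B₁, B₂)
  invFun
    | .inl (B₁, B₂) => .sub B₁ B₂
    | .inr (B₁, B₂) => .disj B₁ B₂
  left_inv := by rintro (_ | _) <;> rfl
  right_inv := by rintro (_ | _) <;> rfl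

instance : Primcodable Inclusion := Primcodable.ofEquiv _ Inclusion.equiv

def Assertion.equiv : Assertion ≃ (ℕ × ℕ) ⊕ (ℕ × ℕ × ℕ) where
  toFun
    | .concept A a => .inl (A, a)
    | .role P a b => .inr (P, a, b)
  invFun
    | .inl (A, a) => .concept A a
    | .inr (P, a, b) => .role P a b
  left_inv := by rintro (_ | _) <;> rfl
  right_inv := by rintro (_ | _) <;> rfl

instance : Primcodable Assertion := Primcodable.ofEquiv _ Assertion.equiv

def Ontology.equiv : Ontology ≃ List Inclusion × List Assertion where
  toFun O := (O.tbox, O.abox)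
  invFun p := ⟨p.1, p.2⟩
  left_inv _ := rfl
  right_inv _ := rfl

instance : Primcodable Ontology := Primcodable.ofEquiv _ Ontology.equiv

def Atom.equiv : Atom ≃ (ℕ × ℕ) ⊕ ((ℕ × ℕ × ℕ) ⊕ (ℕ × ℕ)) where
  toFun
    | .concept A x => .inl (A, x)
    | .role P x y => .inr (.inl (P, x, y))
    | .ne x y => .inr (.inr (x, y))
  invFun
    | .inl (A, x) => .concept A x
    | .inr (.inl (P, x, y)) => .role P x y
    | .inr (.inr (x, y)) => .ne x y
  left_inv := by rintro (_ | _ | _) <;> rfl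
  right_inv := by rintro (_ | _ | _) <;> rfl

instance : Primcodable Atom := Primcodable.ofEquiv _ Atom.equiv

def BCQ.equiv : BCQ ≃ List Atom where
  toFun ψ := ψ.atoms
  invFun l := ⟨l⟩
  left_inv _ := rfl
  right_inv _ := rfl

instance : Primcodable BCQ := Primcodable.ofEquiv _ BCQ.equiv

end DLLite

namespace DLLite

/-! ### Unary algebras axiomatised by conditional equations between words -/

/-! The halting problem is reduced to entailment through finite specifications of unary algebras:
total unary functions, subsets and distinct constants, subject to conditional equations between
words in one variable. A model of the ontology that refutes the query yields an algebra satisfying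
the specification (`Spec.exists_sat`). Conversely, such an algebra with pairwise distinct constants
yields a countermodel (`UnaryAlgebra.isModel`, `UnaryAlgebra.not_query`).

DL-Lite inclusions make each function total on the carrier and express labels. A violation of a
conditional equation is a conjunctive query with one inequality, and functionality is the equation
`f = f` with separate variables for its two sides. The difficulty is that a single conjunctive query
must express that some rule is violated. This disjunction is simulated by a choice of value for the
variable `hub`. A status, live or dead, is attached to vertices. The vertex `hub (t + 1)` demands a
live root for rule `t` and dead roots for all other rules. The exceptional vertex `exc` is dead and
violates every rule at once, since each function leads from it to two distinct dummies; so only rule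
`t` matters. The vertex `hub 0` makes all rules trivial and leaves the statement that some vertex
other than `exc` has a status other than live. Refuting the query there forces every carrier vertex
to be live, so that refuting it at the other hubs enforces every rule on the whole carrier.

Runs of `Turing.ToPartrec.Code` are specified by unary functions on calls, lists and numbers. If the
run ends in `[0]`, the rules force the output constant to have head zero; a fact makes that constant
its own head, so two distinct constants coincide (`not_sat_of_eval`). If the run diverges, the
output is an undefined element `bot`, and the standard algebra satisfies everything (`sat_algebra`).
Rules, TBox and query are fixed for a universal program; only the data encode the input. -/

/-- The conditional equation `conds x → lhs x = rhs x`. A word is a list of function symbols that are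
applied from right to left; a condition `(w, q)` says that the value of `w` at `x` belongs to `q`. -/
structure Rule (F Q : Type) where
  conds : List (List F × Q)
  lhs : List F
  rhs : List F

/-- Ground facts about constants: `q(a)` and `f(a) = b`. -/
inductive Fact (F Q : Type) where
  | pred (q : Q) (a : ℕ)
  | app (f : F) (a b : ℕ)

/-- The constants mentioned in a fact. -/
def Fact.constants {F Q : Type} : Fact F Q → Set ℕ
  | .pred _ a => {a}
  | .app _ a b => {a, b}

/-- A finite specification of unary algebras. A label `(f, q)` says that the range of `f` is contained
in `q`. -/
structure Spec (F Q : Type) where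
  rules : List (Rule F Q)
  labels : List (F × Q)
  facts : List (Fact F Q)

/-- Sets with total unary functions, subsets, and constants. -/
structure UnaryAlgebra (F Q : Type) where
  Carrier : Type u
  fn : F → Carrier → Carrier
  pred : Q → Carrier → Prop
  cst : ℕ → Carrier

variable {F Q : Type}

/-- The value of a word at a point. -/
def UnaryAlgebra.run (A : UnaryAlgebra.{u} F Q) (w : List F) (x : A.Carrier) : A.Carrier :=
  w.foldr A.fn x

@[simp] theorem UnaryAlgebra.run_nil (A : UnaryAlgebra.{u} F Q) (x : A.Carrier) :
    A.run [] x = x := rfl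

@[simp] theorem UnaryAlgebra.run_cons (A : UnaryAlgebra.{u} F Q) (f : F) (w : List F)
    (x : A.Carrier) : A.run (f :: w) x = A.fn f (A.run w x) := rfl

def Rule.Holds (A : UnaryAlgebra.{u} F Q) (ρ : Rule F Q) : Prop :=
  ∀ x, (∀ c ∈ ρ.conds, A.pred c.2 (A.run c.1 x)) → A.run ρ.lhs x = A.run ρ.rhs x

def Fact.Holds (A : UnaryAlgebra.{u} F Q) : Fact F Q → Prop
  | .pred q a => A.pred q (A.cst a)
  | .app f a b => A.fn f (A.cst a) = A.cst b

/-- The constants mentioned in a specification. -/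
def Spec.constants (S : Spec F Q) : Set ℕ := {a | ∃ φ ∈ S.facts, a ∈ φ.constants}

structure Spec.Sat (S : Spec F Q) (A : UnaryAlgebra.{u} F Q) : Prop where
  rules : ∀ ρ ∈ S.rules, ρ.Holds A
  labels : ∀ l ∈ S.labels, ∀ x, A.pred l.2 (A.fn l.1 x)
  facts : ∀ φ ∈ S.facts, φ.Holds A
  inj : Set.InjOn A.cst S.constants

/-! ### The ontology and the query of a specification -/

/-- The constants of the ontology: those of the specification, and the auxiliary ones. -/
inductive Name where
  | alg (a : ℕ)
  | exc
  | dummy (b : Bool)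
  | live
  | dead
  | hub (t : ℕ)
  deriving Inhabited

def Name.code : Name → ℕ
  | .alg a => 2 * a
  | .exc => 1
  | .dummy false => 3
  | .dummy true => 5
  | .live => 7
  | .dead => 9
  | .hub t => 2 * t + 11

theorem Name.code_injective : Function.Injective Name.code := by
  rintro (a | _ | (_ | _) | _ | _ | t) (a' | _ | (_ | _) | _ | _ | t') h <;>
    simp only [Name.code] at h <;> first | rfl | omega | (congr 1; omega)

section Names

variable [Encodable F] [Encodable Q]

/-- Concept names: `0` for the carrier of the algebra, `1` for the exceptional vertex. -/
def predName (q : Q) : ℕ := Encodable.encode q + 2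

/-- Role names: `0` links a vertex to its status (live or dead), `1` and `2` are for the first two
projections of a hub. -/
def fnName (f : F) : ℕ := 2 * Encodable.encode f + 4

def selName (i : ℕ) : ℕ := 2 * i + 3

theorem predName_injective : Function.Injective (predName : Q → ℕ) := fun a b h =>
  Encodable.encode_injective (by simpa [predName] using h)

theorem fnName_injective : Function.Injective (fnName : F → ℕ) := fun a b h =>
  Encodable.encode_injective (by simpa [fnName] using h)

end Names

/-- Query variables. -/
inductive Var where
  | hub
  | src
  | tgt
  | fst
  | snd
  | status (i : ℕ)
  | root (i : ℕ)
  | step (i : ℕ) (b : Bool) (w : List ℕ)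
  deriving Encodable

/-! ### The query as a union of rule violations, and the data that select one of them -/

section Encoding

variable [Encodable F] [Encodable Q]

/-- The variable for the value of the word `w` at the root of the `i`-th rule. -/
def node (i : ℕ) (b : Bool) : List F → Var
  | [] => .root i
  | f :: w => .step i b ((f :: w).map Encodable.encode)

/-- Atoms of the query, over structured variables. -/
inductive VAtom where
  | concept (A : ℕ) (x : Var)
  | role (P : ℕ) (x y : Var)
  | ne (x y : Var)

def VAtom.toAtom : VAtom → Atom
  | .concept A x => .concept A (Encodable.encode x)
  | .role P x y => .role P (Encodable.encode x) (Encodable.encode y)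
  | .ne x y => .ne (Encodable.encode x) (Encodable.encode y)

def VAtom.Holds (I : Interp.{u}) (g : Var → I.Dom) : VAtom → Prop
  | .concept A x => I.concept A (g x)
  | .role P x y => I.role P (g x) (g y)
  | .ne x y => g x ≠ g y

def pathAtoms (i : ℕ) (b : Bool) : List F → List VAtom
  | [] => []
  | f :: w => .role (fnName f) (node i b w) (node i b (f :: w)) :: pathAtoms i b w

/-- A violation of the rule at a root whose status is prescribed by the hub. The two sides share
only the root. Conditions reuse the variables of the right branch, which is harmless because equal
words have equal values under functions. -/
def ruleAtoms (i : ℕ) (ρ : Rule F Q) : List VAtom :=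
  [.role (selName i) .hub (.status i), .role 0 (.root i) (.status i),
    .ne (node i false ρ.lhs) (node i true ρ.rhs)] ++
  pathAtoms i false ρ.lhs ++ pathAtoms i true ρ.rhs ++
  ρ.conds.flatMap fun c => .concept (predName c.2) (node i true c.1) :: pathAtoms i true c.1

def functionality (f : F) : Rule F Q := ⟨[], [f], [f]⟩

variable [Fintype F]

/-- The rules of a specification, with the functionality of all its function symbols. -/
noncomputable def Spec.allRules (S : Spec F Q) : List (Rule F Q) :=
  Finset.univ.toList.map functionality ++ S.rules

/-- The first five atoms have content only at `hub 0`, where `fst` is live and `snd` is `exc`. At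
any other hub both projections return the hub itself, and the edge from `exc` to dead satisfies both
inequalities. -/
noncomputable def Spec.vatoms (S : Spec F Q) : List VAtom :=
  [.role 1 .hub .fst, .role 2 .hub .snd, .role 0 .src .tgt, .ne .tgt .fst, .ne .src .snd] ++
  (List.finRange S.allRules.length).flatMap fun i : Fin _ => ruleAtoms i (S.allRules.get i)

noncomputable def Spec.query (S : Spec F Q) : BCQ := ⟨S.vatoms.map VAtom.toAtom⟩

noncomputable def Spec.tbox (S : Spec F Q) : List Inclusion :=
  [.sub (.name 0) (.exist (.name 0)), .disj (.name 0) (.name 1)] ++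
  Finset.univ.toList.flatMap (fun f : F =>
    [.sub (.name 0) (.exist (.name (fnName f))), .sub (.exist (.inv (fnName f))) (.name 0)]) ++
  S.labels.map fun l => .sub (.exist (.inv (fnName l.1))) (.name (predName l.2))

/-- The target `b` needs no carrier assertion: it is in the range of `f`, which the TBox puts into
the carrier. -/
def Fact.toAssertions : Fact F Q → List Assertion
  | .pred q a => [.concept 0 (Name.alg a).code, .concept (predName q) (Name.alg a).code]
  | .app f a b =>
    [.concept 0 (Name.alg a).code, .role (fnName f) (Name.alg a).code (Name.alg b).code]

variable (F Q) in
/-- The part of the data that does not depend on the facts; `k` is the number of rules. -/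
noncomputable def auxAssertions [Fintype Q] (k : ℕ) : List Assertion :=
  [.concept 1 Name.exc.code, .role 0 Name.exc.code Name.dead.code,
    .role 1 (Name.hub 0).code Name.live.code, .role 2 (Name.hub 0).code Name.exc.code] ++
  Finset.univ.toList.flatMap (fun f : F => [false, true].flatMap fun b =>
    [.role (fnName f) Name.exc.code (Name.dummy b).code,
      .role (fnName f) (Name.dummy b).code (Name.dummy b).code]) ++
  Finset.univ.toList.flatMap (fun q : Q =>
    [.concept (predName q) Name.exc.code, .concept (predName q) (Name.dummy false).code,
      .concept (predName q) (Name.dummy true).code]) ++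
  (List.range k).flatMap (fun t =>
    [.role 1 (Name.hub (t + 1)).code (Name.hub (t + 1)).code,
      .role 2 (Name.hub (t + 1)).code (Name.hub (t + 1)).code]) ++
  (List.range (k + 1)).flatMap fun t => (List.range k).map fun j =>
    .role (selName j) (Name.hub t).code (if t = j + 1 then Name.live else Name.dead).code

noncomputable def Spec.ontology [Fintype Q] (S : Spec F Q) : Ontology where
  tbox := S.tbox
  abox := auxAssertions F Q S.allRules.length ++ S.facts.flatMap Fact.toAssertions

theorem VAtom.toAtom_holds (I : Interp.{u}) (v : ℕ → I.Dom) (α : VAtom) :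
    α.toAtom.Holds I v ↔ α.Holds I (v ∘ Encodable.encode) := by
  cases α <;> rfl

theorem Spec.query_holds (S : Spec F Q) (I : Interp.{u}) :
    S.query.Holds I ↔ ∃ g : Var → I.Dom, ∀ α ∈ S.vatoms, α.Holds I g := by
  constructor
  · rintro ⟨v, hv⟩
    refine ⟨v ∘ Encodable.encode, fun α hα => ?_⟩
    rw [← VAtom.toAtom_holds]
    exact hv _ (List.mem_map_of_mem hα)
  · rintro ⟨g, hg⟩
    refine ⟨fun n => ((Encodable.decode n).map g).getD (I.const 0), fun α hα => ?_⟩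
    obtain ⟨β, hβ, rfl⟩ := List.mem_map.1 hα
    rw [VAtom.toAtom_holds]
    convert hg β hβ using 1
    funext x
    simp

end Encoding

end DLLite

/-! ### Consequences of refuting the query -/

namespace DLLite

variable {F Q : Type} [Encodable F] [Encodable Q] [Fintype F]

omit [Fintype F] in
/-- The path atoms hold if consecutive values `a` along the word are linked. -/
theorem pathAtoms_holds {I : Interp.{u}} {g : Var → I.Dom} {i : ℕ} {b : Bool}
    {a : List F → I.Dom} (ha : ∀ w, g (node i b w) = a w) {w : List F}
    (h : ∀ f w', (f :: w') <:+ w → I.role (fnName f) (a w') (a (f :: w'))) :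
    ∀ α ∈ pathAtoms i b w, α.Holds I g := by
  induction w with
  | nil => simp [pathAtoms]
  | cons f w ih =>
    intro α hα
    rcases List.mem_cons.1 hα with rfl | hα
    · simpa only [VAtom.Holds, ha] using h f w List.suffix_rfl
    · exact ih (fun f' w' h' => h f' w' (h'.trans (List.suffix_cons f w))) α hα

omit [Fintype F] in
theorem ruleAtoms_holds {I : Interp.{u}} {g : Var → I.Dom} {i : ℕ} {ρ : Rule F Q}
    {a : Bool → List F → I.Dom} (ha : ∀ b w, g (node i b w) = a b w)
    (hsel : I.role (selName i) (g .hub) (g (.status i)))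
    (hst : I.role 0 (g (.root i)) (g (.status i)))
    (hne : a false ρ.lhs ≠ a true ρ.rhs)
    (hl : ∀ f w, (f :: w) <:+ ρ.lhs → I.role (fnName f) (a false w) (a false (f :: w)))
    (hr : ∀ f w, (f :: w) <:+ ρ.rhs → I.role (fnName f) (a true w) (a true (f :: w)))
    (hc : ∀ c ∈ ρ.conds, I.concept (predName c.2) (a true c.1) ∧
      ∀ f w, (f :: w) <:+ c.1 → I.role (fnName f) (a true w) (a true (f :: w))) :
    ∀ α ∈ ruleAtoms i ρ, α.Holds I g := by
  intro α hα
  simp only [ruleAtoms, List.mem_append, List.mem_flatMap, List.mem_cons, List.not_mem_nil,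
    or_false] at hα
  rcases hα with (((rfl | rfl | rfl) | hα) | hα) | ⟨c, hcm, (rfl | hα)⟩
  · exact hsel
  · exact hst
  · simpa only [VAtom.Holds, ha] using hne
  · exact pathAtoms_holds (ha false) hl α hα
  · exact pathAtoms_holds (ha true) hr α hα
  · simpa only [VAtom.Holds, ha] using (hc c hcm).1
  · exact pathAtoms_holds (ha true) (hc c hcm).2 α hα

/-- The assignment that sends the `i`-th rule to the exceptional vertex and the dummies. -/
def dummyValue (I : Interp.{u}) (b : Bool) : List F → I.Dom
  | [] => I.const Name.exc.code
  | _ :: _ => I.const (Name.dummy b).code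

/-- The facts that every model of the ontology of a specification has about auxiliary vertices. -/
structure AuxFacts (F Q : Type) [Encodable F] [Encodable Q] (k : ℕ) (I : Interp.{u}) : Prop where
  exc : I.concept 1 (I.const Name.exc.code)
  excDead : I.role 0 (I.const Name.exc.code) (I.const Name.dead.code)
  hubLive : I.role 1 (I.const (Name.hub 0).code) (I.const Name.live.code)
  hubExc : I.role 2 (I.const (Name.hub 0).code) (I.const Name.exc.code)
  excDummy : ∀ (f : F) b, I.role (fnName f) (I.const Name.exc.code) (I.const (Name.dummy b).code)
  dummyDummy : ∀ (f : F) b,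
    I.role (fnName f) (I.const (Name.dummy b).code) (I.const (Name.dummy b).code)
  predExc : ∀ q : Q, I.concept (predName q) (I.const Name.exc.code)
  predDummy : ∀ (q : Q) b, I.concept (predName q) (I.const (Name.dummy b).code)
  hubFst : ∀ t < k,
    I.role 1 (I.const (Name.hub (t + 1)).code) (I.const (Name.hub (t + 1)).code)
  hubSnd : ∀ t < k,
    I.role 2 (I.const (Name.hub (t + 1)).code) (I.const (Name.hub (t + 1)).code)
  sel : ∀ t < k + 1, ∀ j < k, I.role (selName j) (I.const (Name.hub t).code)
    (I.const (if t = j + 1 then Name.live else Name.dead).code)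

theorem auxFacts_iff [Fintype Q] {k : ℕ} {I : Interp.{u}} :
    (∀ α ∈ auxAssertions F Q k, α.Holds I) ↔ AuxFacts F Q k I := by
  constructor
  · intro h
    simp only [auxAssertions, List.mem_append, List.mem_flatMap, List.mem_map, List.mem_cons,
      List.not_mem_nil, or_false, Finset.mem_toList, Finset.mem_univ, true_and,
      List.mem_range] at h
    refine ⟨h (.concept 1 _) ?_, h (.role 0 _ _) ?_, h (.role 1 _ _) ?_, h (.role 2 _ _) ?_,
      fun f b => h (.role _ _ _) ?_, fun f b => h (.role _ _ _) ?_, fun q => h (.concept _ _) ?_,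
      fun q b => h (.concept _ _) ?_, fun t ht => h (.role 1 _ _) ?_,
      fun t ht => h (.role 2 _ _) ?_, fun t ht j hj => h (.role _ _ _) ?_⟩
    · simp
    · simp
    · simp
    · simp
    · exact .inl (.inl (.inl (.inr ⟨f, b, by cases b <;> simp, .inl rfl⟩)))
    · exact .inl (.inl (.inl (.inr ⟨f, b, by cases b <;> simp, .inr rfl⟩)))
    · exact .inl (.inl (.inr ⟨q, .inl rfl⟩))
    · exact .inl (.inl (.inr ⟨q, by cases b <;> simp⟩))
    · exact .inl (.inr ⟨t, ht, .inl rfl⟩)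
    · exact .inl (.inr ⟨t, ht, .inr rfl⟩)
    · exact .inr ⟨t, ht, j, hj, rfl⟩
  · intro h α hα
    simp only [auxAssertions, List.mem_append, List.mem_flatMap, List.mem_map, List.mem_cons,
      List.not_mem_nil, or_false, Finset.mem_toList, Finset.mem_univ, true_and,
      List.mem_range] at hα
    rcases hα with (((((rfl | rfl | rfl | rfl) | ⟨f, b, -, (rfl | rfl)⟩) |
      ⟨q, (rfl | rfl | rfl)⟩) | ⟨t, ht, (rfl | rfl)⟩) | ⟨t, ht, j, hj, rfl⟩)
    · exact h.exc
    · exact h.excDead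
    · exact h.hubLive
    · exact h.hubExc
    · exact h.excDummy f b
    · exact h.dummyDummy f b
    · exact h.predExc q
    · exact h.predDummy q _
    · exact h.predDummy q _
    · exact h.hubFst t ht
    · exact h.hubSnd t ht
    · exact h.sel t ht j hj

omit [Encodable F] [Encodable Q] in
theorem Spec.exists_get_allRules (S : Spec F Q) {ρ : Rule F Q} (h : ρ ∈ S.allRules) :
    ∃ i : Fin S.allRules.length, S.allRules.get i = ρ := List.mem_iff_get.1 h

/-- A structure with the auxiliary facts that refutes the query satisfies all rules at the vertices
that are linked to the live status only, and all other vertices are linked to it. -/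
theorem Spec.eq_of_not_query {S : Spec F Q} {I : Interp.{u}}
    (haux : AuxFacts F Q S.allRules.length I)
    (hname : ∀ x y : Name, (∀ a, x ≠ .alg a) → (∀ a, y ≠ .alg a) →
      (∀ t, x = .hub t → t ≤ S.allRules.length) → (∀ t, y = .hub t → t ≤ S.allRules.length) →
      I.const x.code = I.const y.code → x = y)
    (hlhs : ∀ ρ ∈ S.allRules, ρ.lhs ≠ []) (hψ : ¬ S.query.Holds I) :
    (∀ x z, I.role 0 x z → x ≠ I.const Name.exc.code → z = I.const Name.live.code) ∧
    ∀ ρ ∈ S.allRules, ∀ x, I.role 0 x (I.const Name.live.code) →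
      ∀ a : Bool → List F → I.Dom, (∀ b, a b [] = x) →
      (∀ f w, (f :: w) <:+ ρ.lhs → I.role (fnName f) (a false w) (a false (f :: w))) →
      (∀ f w, (f :: w) <:+ ρ.rhs → I.role (fnName f) (a true w) (a true (f :: w))) →
      (∀ c ∈ ρ.conds, I.concept (predName c.2) (a true c.1) ∧
        ∀ f w, (f :: w) <:+ c.1 → I.role (fnName f) (a true w) (a true (f :: w))) →
      a false ρ.lhs = a true ρ.rhs := by
  classical
  rw [Spec.query_holds] at hψ
  push Not at hψ
  have dne : ∀ ρ ∈ S.allRules, dummyValue I false ρ.lhs ≠ dummyValue I true ρ.rhs := by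
    -- A nonempty left side ends at `dummy false`, the right side at `exc` or `dummy true`. Two
    -- empty sides would both end at `exc`, hence the hypothesis `hlhs`.
    intro ρ hρ h
    have hl := hlhs ρ hρ
    rcases hL : ρ.lhs with _ | ⟨f, w⟩
    · exact hl hL
    rw [hL] at h
    rcases hR : ρ.rhs with _ | ⟨f', w'⟩ <;> rw [hR] at h <;>
      have := hname _ _ (by simp) (by simp) (by simp) (by simp) h <;> simp at this
  have drole : ∀ (b : Bool) (f : F) (w : List F),
      I.role (fnName f) (dummyValue I b w) (dummyValue I b (f :: w)) := by
    rintro b f (_ | ⟨f', w⟩)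
    · exact haux.excDummy f b
    · exact haux.dummyDummy f b
  have dpred : ∀ (b : Bool) (q : Q) (w : List F), I.concept (predName q) (dummyValue I b w) := by
    rintro b q (_ | ⟨f', w⟩)
    · exact haux.predExc q
    · exact haux.predDummy q b
  constructor
  · intro x z hxz hx
    by_contra hz
    -- At `hub 0` every rule is violated at `exc`, so an edge from `x ≠ exc` to a status other than
    -- live would satisfy the whole query.
    let g : Var → I.Dom := fun
      | .hub => I.const (Name.hub 0).code
      | .src => x
      | .tgt => z
      | .fst => I.const Name.live.code
      | .snd => I.const Name.exc.code
      | .status _ => I.const Name.dead.code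
      | .root _ => I.const Name.exc.code
      | .step _ b _ => I.const (Name.dummy b).code
    obtain ⟨α, hα, hα'⟩ := hψ g
    apply hα'
    simp only [Spec.vatoms, List.mem_append, List.mem_flatMap, List.mem_finRange, true_and,
      List.mem_cons, List.not_mem_nil, or_false] at hα
    rcases hα with (rfl | rfl | rfl | rfl | rfl) | ⟨i, hα⟩
    · exact haux.hubLive
    · exact haux.hubExc
    · exact hxz
    · exact hz
    · exact hx
    · refine ruleAtoms_holds (a := dummyValue I) ?_ ?_ haux.excDead
        (dne _ (List.get_mem _ _)) (fun f w _ => drole _ f w) (fun f w _ => drole _ f w)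
        (fun c _ => ⟨dpred _ _ _, fun f w _ => drole _ f w⟩) α hα
      · rintro b (_ | ⟨f, w⟩) <;> rfl
      · simpa using haux.sel 0 (by omega) i i.2
  · intro ρ hρ x hx a ha hl hr hc
    obtain ⟨i, rfl⟩ := S.exists_get_allRules hρ
    by_contra hne
    -- At `hub (i + 1)` rule `i` gets the supposed violation at `x`, and all other rules are sent to
    -- `exc` and the dummies.
    let g : Var → I.Dom := fun
      | .hub => I.const (Name.hub (i + 1)).code
      | .src => I.const Name.exc.code
      | .tgt => I.const Name.dead.code
      | .fst => I.const (Name.hub (i + 1)).code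
      | .snd => I.const (Name.hub (i + 1)).code
      | .status j => I.const (if j = (i : ℕ) then Name.live else Name.dead).code
      | .root j => if j = i then x else I.const Name.exc.code
      | .step j b w => if j = i then a b (w.filterMap Encodable.decode)
          else I.const (Name.dummy b).code
    obtain ⟨α, hα, hα'⟩ := hψ g
    apply hα'
    simp only [Spec.vatoms, List.mem_append, List.mem_flatMap, List.mem_finRange, true_and,
      List.mem_cons, List.not_mem_nil, or_false] at hα
    rcases hα with (rfl | rfl | rfl | rfl | rfl) | ⟨j, hα⟩
    · exact haux.hubFst i i.2
    · exact haux.hubSnd i i.2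
    · exact haux.excDead
    · intro h
      have := hname _ _ (by simp) (by simp) (by simp) (by simp) h
      simp at this
    · intro h
      have := hname _ _ (by simp) (by simp) (by simp) (by simp) h
      simp at this
    · by_cases hji : j = i
      · subst hji
        refine ruleAtoms_holds (a := a) ?_ ?_ ?_ hne hl hr hc α hα
        · rintro b (_ | ⟨f, w⟩)
          · simp [g, node, ha]
          · simp [g, node, List.filterMap_map]
        · simpa [g] using haux.sel (j + 1) (by omega) j j.2
        · simpa [g] using hx
      · have hji' : (j : ℕ) ≠ i := fun h => hji (Fin.ext h)
        refine ruleAtoms_holds (a := dummyValue I) ?_ ?_ ?_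
          (dne _ (List.get_mem _ _)) (fun f w _ => drole _ f w) (fun f w _ => drole _ f w)
          (fun c _ => ⟨dpred _ _ _, fun f w _ => drole _ f w⟩) α hα
        · rintro b (_ | ⟨f, w⟩) <;> simp [g, node, hji', dummyValue]
        · simpa [g, hji', Ne.symm hji'] using haux.sel (i + 1) (by omega) j j.2
        · simpa [g, hji'] using haux.excDead

end DLLite

/-! ### From a model refuting the query to an algebra -/

namespace DLLite

variable {F Q : Type} [Encodable F] [Encodable Q] [Fintype F] [Fintype Q]

theorem Spec.const_injOn [Nonempty F] (S : Spec F Q) {I : Interp.{u}} (hI : S.ontology.IsModel I)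
    {x y : Name} (hx : ∀ a, x = .alg a → a ∈ S.constants) (hy : ∀ a, y = .alg a → a ∈ S.constants)
    (hx' : ∀ t, x = .hub t → t ≤ S.allRules.length)
    (hy' : ∀ t, y = .hub t → t ≤ S.allRules.length)
    (h : I.const x.code = I.const y.code) : x = y := by
  have key : ∀ z : Name, (∀ a, z = .alg a → a ∈ S.constants) →
      (∀ t, z = .hub t → t ≤ S.allRules.length) → z.code ∈ S.ontology.constants := by
    intro z hz hz'
    have hmem : ∀ {α : Assertion}, α ∈ auxAssertions F Q S.allRules.length →
        z.code ∈ α.constants → z.code ∈ S.ontology.constants := fun h₁ h₂ =>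
      ⟨_, List.mem_append_left _ h₁, h₂⟩
    obtain ⟨f⟩ := ‹Nonempty F›
    have hdummy : ∀ b, (.role (fnName f) Name.exc.code (Name.dummy b).code : Assertion) ∈
        auxAssertions F Q S.allRules.length := by
      intro b
      simp only [auxAssertions, List.mem_append, List.mem_flatMap, Finset.mem_toList]
      exact .inl (.inl (.inl (.inr ⟨f, Finset.mem_univ _, b, by cases b <;> simp, by simp⟩)))
    rcases z with a | _ | b | _ | _ | t
    · obtain ⟨φ, hφ, ha⟩ := hz a rfl
      rcases φ with ⟨q, a'⟩ | ⟨f, a', b⟩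
      · obtain rfl : a = a' := ha
        exact ⟨.concept 0 (Name.alg a).code, List.mem_append_right _
          (List.mem_flatMap.2 ⟨_, hφ, by simp [Fact.toAssertions]⟩), rfl⟩
      · refine ⟨.role (fnName f) (Name.alg a').code (Name.alg b).code, List.mem_append_right _
          (List.mem_flatMap.2 ⟨_, hφ, by simp [Fact.toAssertions]⟩), ?_⟩
        rcases ha with rfl | rfl
        · exact .inl rfl
        · exact .inr rfl
    · exact hmem (hdummy true) (.inl rfl)
    · exact hmem (hdummy b) (.inr rfl)
    · exact hmem (α := .role 1 (Name.hub 0).code Name.live.code) (by simp [auxAssertions]) (.inr rfl)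
    · exact hmem (α := .role 0 Name.exc.code Name.dead.code) (by simp [auxAssertions]) (.inr rfl)
    · rcases t with _ | t
      · exact hmem (α := .role 1 (Name.hub 0).code Name.live.code) (by simp [auxAssertions])
          (.inl rfl)
      · refine hmem (α := .role 1 (Name.hub (t + 1)).code (Name.hub (t + 1)).code) ?_ (.inl rfl)
        have := hz' _ rfl
        simp only [auxAssertions, List.mem_append, List.mem_flatMap, List.mem_range]
        exact .inl (.inr ⟨t, by omega, by simp⟩)
  exact Name.code_injective (hI.uniqueNames (key x hx hx') (key y hy hy') h)

/-- From a model of the ontology that refutes the query, an algebra that satisfies the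
specification. -/
theorem Spec.exists_sat [Nonempty F] (S : Spec F Q) (hS : ∀ ρ ∈ S.rules, ρ.lhs ≠ [])
    {I : Interp.{u}} (hI : S.ontology.IsModel I) (hψ : ¬ S.query.Holds I) :
    ∃ A : UnaryAlgebra.{u} F Q, S.Sat A := by
  classical
  have haux : AuxFacts F Q S.allRules.length I :=
    auxFacts_iff.1 fun α hα => hI.abox α (List.mem_append_left _ hα)
  have hS' : ∀ ρ ∈ S.allRules, ρ.lhs ≠ [] := by
    intro ρ hρ
    rcases List.mem_append.1 hρ with hρ | hρ
    · obtain ⟨f, -, rfl⟩ := List.mem_map.1 hρ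
      simp [functionality]
    · exact hS ρ hρ
  obtain ⟨hlive, hrule⟩ := S.eq_of_not_query haux
    (fun x y hx hy hx' hy' h => S.const_injOn hI (fun a h => absurd h (hx a))
      (fun a h => absurd h (hy a)) hx' hy' h) hS' hψ
  have htbox : ∀ τ ∈ S.tbox, τ.Holds I := hI.tbox
  simp only [Spec.tbox, List.mem_append, List.mem_flatMap, List.mem_map, List.mem_cons,
    List.not_mem_nil, or_false, Finset.mem_toList, Finset.mem_univ, true_and] at htbox
  -- A carrier vertex has some status; it differs from `exc` by disjointness, so that status is
  -- live.
  have hlink : ∀ x, I.concept 0 x → I.role 0 x (I.const Name.live.code) := by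
    intro x hx
    obtain ⟨z, hz⟩ : ∃ z, I.role 0 x z :=
      htbox (.sub (.name 0) (.exist (.name 0))) (.inl (.inl (.inl rfl))) x hx
    have hz' : I.role 0 x z := hz
    have := hlive x z hz' fun h =>
      htbox (.disj (.name 0) (.name 1)) (.inl (.inl (.inr rfl))) x hx (h ▸ haux.exc)
    rwa [this] at hz'
  have htot : ∀ (f : F) (x : {x // I.concept 0 x}), ∃ y : {x // I.concept 0 x},
      I.role (fnName f) x y := by
    intro f x
    obtain ⟨y, hy⟩ : ∃ y, I.role (fnName f) x y :=
      htbox (.sub (.name 0) (.exist (.name (fnName f)))) (.inl (.inr ⟨f, .inl rfl⟩)) x x.2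
    exact ⟨⟨y, htbox (.sub (.exist (.inv (fnName f))) (.name 0)) (.inl (.inr ⟨f, .inr rfl⟩)) y
      ⟨x, hy⟩⟩, hy⟩
  choose fn hfn using htot
  have hfun : ∀ (f : F) (x : {x // I.concept 0 x}) (y : I.Dom),
      I.role (fnName f) x y → y = fn f x := by
    intro f x y hy
    -- The two branches of the rule `f = f` are sent to the two successors `y` and `fn f x`.
    have := hrule (functionality f) (List.mem_append_left _ (List.mem_map_of_mem (by simp))) x
      (hlink x x.2) (fun b w => if w = [] then x else if b then fn f x else y) (by simp)
      ?_ ?_ (by simp [functionality])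
    · simpa [functionality] using this
    · intro f' w hw
      obtain ⟨rfl, rfl⟩ : f' = f ∧ w = [] := by
        simpa [functionality, List.suffix_cons_iff] using hw
      simpa using hy
    · intro f' w hw
      obtain ⟨rfl, rfl⟩ : f' = f ∧ w = [] := by
        simpa [functionality, List.suffix_cons_iff] using hw
      simpa using hfn f' x
  obtain ⟨f₀⟩ := ‹Nonempty F›
  -- A dummy lies in the range of `f₀`, so the carrier is inhabited; this is the value of constants
  -- that the specification does not mention.
  let pt : {x // I.concept 0 x} := ⟨_, htbox (.sub (.exist (.inv (fnName f₀))) (.name 0))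
      (.inl (.inr ⟨f₀, .inr rfl⟩)) _ ⟨_, haux.excDummy f₀ true⟩⟩
  let A : UnaryAlgebra.{u} F Q :=
    { Carrier := {x // I.concept 0 x}
      fn := fn
      pred := fun q x => I.concept (predName q) x
      cst := fun a => if h : I.concept 0 (I.const (Name.alg a).code) then ⟨_, h⟩ else pt }
  have hfacts : ∀ φ ∈ S.facts, ∀ α ∈ φ.toAssertions, α.Holds I := fun φ hφ α hα =>
    hI.abox α (List.mem_append_right _ (List.mem_flatMap.2 ⟨φ, hφ, hα⟩))
  have hcst : ∀ a ∈ S.constants, ((A.cst a : {x // I.concept 0 x}) : I.Dom) =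
      I.const (Name.alg a).code := by
    rintro a ⟨φ, hφ, ha⟩
    have : I.concept 0 (I.const (Name.alg a).code) := by
      rcases φ with ⟨q, a'⟩ | ⟨f, a', b⟩
      · obtain rfl : a = a' := ha
        exact hfacts _ hφ (.concept 0 (Name.alg a).code) (by simp [Fact.toAssertions])
      · rcases ha with rfl | rfl
        · exact hfacts _ hφ (.concept 0 (Name.alg a).code) (by simp [Fact.toAssertions])
        · exact htbox (.sub (.exist (.inv (fnName f))) (.name 0)) (.inl (.inr ⟨f, .inr rfl⟩)) _
            ⟨_, hfacts _ hφ (.role (fnName f) (Name.alg a').code (Name.alg a).code)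
              (by simp [Fact.toAssertions])⟩
    simp only [A, dif_pos this]
  refine ⟨A, ?_, ?_, ?_, ?_⟩
  · intro ρ hρ x hx
    exact Subtype.ext (hrule ρ (List.mem_append_right _ hρ) x.1 (hlink x.1 x.2)
      (fun _ w => (A.run w x).1) (fun _ => rfl) (fun f w _ => hfn f (A.run w x))
      (fun f w _ => hfn f (A.run w x))
      (fun c hc => ⟨hx c hc, fun f w _ => hfn f (A.run w x)⟩))
  · intro l hl x
    exact htbox (.sub (.exist (.inv (fnName l.1))) (.name (predName l.2))) (.inr ⟨l, hl, rfl⟩)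
      _ ⟨_, hfn l.1 x⟩
  · rintro (⟨q, a⟩ | ⟨f, a, b⟩) hφ
    · have ha := hcst a ⟨_, hφ, rfl⟩
      have := hfacts _ hφ (.concept (predName q) (Name.alg a).code) (by simp [Fact.toAssertions])
      change I.concept (predName q) (A.cst a : {x // I.concept 0 x})
      rwa [ha]
    · have ha := hcst a ⟨_, hφ, .inl rfl⟩
      have hb := hcst b ⟨_, hφ, .inr rfl⟩
      refine (Subtype.ext (hfun f (A.cst a) (A.cst b : {x // I.concept 0 x}).1 ?_)).symm
      rw [ha, hb]
      exact hfacts _ hφ (.role (fnName f) (Name.alg a).code (Name.alg b).code)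
        (by simp [Fact.toAssertions])
  · intro a ha b hb h
    have := S.const_injOn hI (x := .alg a) (y := .alg b) (by rintro _ ⟨⟩; exact ha)
      (by rintro _ ⟨⟩; exact hb) (by simp) (by simp)
      (by rw [← hcst a ha, ← hcst b hb]; exact congrArg Subtype.val h)
    simpa using this

/-! ### A model from an algebra -/

/-- The vertices: those of the algebra, and the auxiliary ones. -/
inductive Vertex (α : Type u) : Type u where
  | alg (x : α)
  | exc
  | dummy (b : Bool)
  | live
  | dead
  | hub (t : ℕ)

/-- The vertices on which the algebra operations live, namely those of the algebra and the dummies. -/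
inductive Vertex.Real {α : Type u} : Vertex α → Prop
  | alg (x : α) : Real (.alg x)
  | dummy (b : Bool) : Real (.dummy b)

namespace UnaryAlgebra

omit [Fintype F] [Fintype Q]

/-- The interpretation of a name. -/
def vertex (A : UnaryAlgebra.{u} F Q) : Name → Vertex A.Carrier
  | .alg a => .alg (A.cst a)
  | .exc => .exc
  | .dummy b => .dummy b
  | .live => .live
  | .dead => .dead
  | .hub t => .hub t

/-- The graph of the function symbol `f` on the vertices. -/
inductive Edge (A : UnaryAlgebra.{u} F Q) (f : F) : Vertex A.Carrier → Vertex A.Carrier → Prop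
  | alg (x : A.Carrier) : Edge A f (.alg x) (.alg (A.fn f x))
  | dummy (b : Bool) : Edge A f (.dummy b) (.dummy b)
  | exc (b : Bool) : Edge A f .exc (.dummy b)

/-- The extension of the predicate symbol `q` on the vertices. -/
inductive Mem (A : UnaryAlgebra.{u} F Q) (q : Q) : Vertex A.Carrier → Prop
  | alg (x : A.Carrier) (h : A.pred q x) : Mem A q (.alg x)
  | dummy (b : Bool) : Mem A q (.dummy b)
  | exc : Mem A q .exc

/-- The interpretation of role names. -/
inductive RoleHolds (A : UnaryAlgebra.{u} F Q) (k : ℕ) :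
    ℕ → Vertex A.Carrier → Vertex A.Carrier → Prop
  | live (x) (h : x.Real) : RoleHolds A k 0 x .live
  | dead : RoleHolds A k 0 .exc .dead
  | fst : RoleHolds A k 1 (.hub 0) .live
  | snd : RoleHolds A k 2 (.hub 0) .exc
  | fst_succ (t : ℕ) (ht : t < k) : RoleHolds A k 1 (.hub (t + 1)) (.hub (t + 1))
  | snd_succ (t : ℕ) (ht : t < k) : RoleHolds A k 2 (.hub (t + 1)) (.hub (t + 1))
  | sel (t j : ℕ) (ht : t < k + 1) (hj : j < k) :
    RoleHolds A k (selName j) (.hub t) (if t = j + 1 then .live else .dead)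
  | fn (f : F) (x y) (h : A.Edge f x y) : RoleHolds A k (fnName f) x y

/-- The interpretation of concept names. -/
inductive ConceptHolds (A : UnaryAlgebra.{u} F Q) : ℕ → Vertex A.Carrier → Prop
  | real (x) (h : x.Real) : ConceptHolds A 0 x
  | exc : ConceptHolds A 1 .exc
  | pred (q : Q) (x) (h : A.Mem q x) : ConceptHolds A (predName q) x

/-- The interpretation of constants. -/
noncomputable def const (A : UnaryAlgebra.{u} F Q) (n : ℕ) : Vertex A.Carrier :=
  A.vertex (Function.invFun Name.code n)

omit [Encodable F] [Encodable Q] in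
theorem const_code (A : UnaryAlgebra.{u} F Q) (x : Name) : A.const x.code = A.vertex x := by
  rw [const, Function.leftInverse_invFun Name.code_injective]

/-- The relational structure that belongs to an algebra. -/
noncomputable abbrev toInterp (A : UnaryAlgebra.{u} F Q) (k : ℕ) : Interp.{u} where
  Dom := Vertex A.Carrier
  const := A.const
  concept := A.ConceptHolds
  role := A.RoleHolds k

/-! ### Inversion of the interpreted roles and concepts -/

variable (A : UnaryAlgebra.{u} F Q) {k : ℕ}

theorem role_status {x y : Vertex A.Carrier} : (A.toInterp k).role 0 x y ↔
    (Vertex.Real x ∧ y = .live) ∨ (x = .exc ∧ y = .dead) := by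
  constructor
  · intro h
    change A.RoleHolds k 0 x y at h
    generalize hP : (0 : ℕ) = P at h
    cases h <;> simp_all [selName, fnName]
  · rintro (⟨h, rfl⟩ | ⟨rfl, rfl⟩)
    · exact .live _ h
    · exact .dead

theorem role_fst {x y : Vertex A.Carrier} : (A.toInterp k).role 1 x y ↔
    (x = .hub 0 ∧ y = .live) ∨ ∃ t < k, x = .hub (t + 1) ∧ y = .hub (t + 1) := by
  constructor
  · intro h
    change A.RoleHolds k 1 x y at h
    generalize hP : (1 : ℕ) = P at h
    cases h <;> simp_all [selName, fnName]
  · rintro (⟨rfl, rfl⟩ | ⟨t, ht, rfl, rfl⟩)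
    · exact .fst
    · exact .fst_succ t ht

theorem role_snd {x y : Vertex A.Carrier} : (A.toInterp k).role 2 x y ↔
    (x = .hub 0 ∧ y = .exc) ∨ ∃ t < k, x = .hub (t + 1) ∧ y = .hub (t + 1) := by
  constructor
  · intro h
    change A.RoleHolds k 2 x y at h
    generalize hP : (2 : ℕ) = P at h
    cases h <;> simp_all [selName, fnName]
  · rintro (⟨rfl, rfl⟩ | ⟨t, ht, rfl, rfl⟩)
    · exact .snd
    · exact .snd_succ t ht

theorem role_sel {j : ℕ} {x y : Vertex A.Carrier} : (A.toInterp k).role (selName j) x y ↔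
    ∃ t < k + 1, j < k ∧ x = .hub t ∧ y = if t = j + 1 then .live else .dead := by
  constructor
  · intro h
    change A.RoleHolds k (selName j) x y at h
    generalize hP : selName j = P at h
    cases h with
    | sel t i ht hi =>
      obtain rfl : j = i := by simpa [selName] using hP
      exact ⟨t, ht, hi, rfl, rfl⟩
    | _ => simp only [selName, fnName] at hP; omega
  · rintro ⟨t, ht, hj, rfl, rfl⟩
    exact .sel t j ht hj

theorem role_fn {f : F} {x y : Vertex A.Carrier} : (A.toInterp k).role (fnName f) x y ↔ A.Edge f x y := by
  constructor
  · intro h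
    change A.RoleHolds k (fnName f) x y at h
    generalize hP : fnName f = P at h
    cases h with
    | fn f' x y h =>
      obtain rfl : f = f' := fnName_injective hP
      exact h
    | _ => simp only [selName, fnName] at hP; omega
  · exact .fn f x y

theorem concept_real {x : Vertex A.Carrier} : (A.toInterp k).concept 0 x ↔ Vertex.Real x := by
  constructor
  · intro h
    change A.ConceptHolds 0 x at h
    generalize hP : (0 : ℕ) = P at h
    cases h <;> simp_all [predName]
  · exact .real x

theorem concept_exc {x : Vertex A.Carrier} : (A.toInterp k).concept 1 x ↔ x = .exc := by
  constructor
  · intro h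
    change A.ConceptHolds 1 x at h
    generalize hP : (1 : ℕ) = P at h
    cases h <;> simp_all [predName]
  · rintro rfl
    exact .exc

theorem concept_pred {q : Q} {x : Vertex A.Carrier} : (A.toInterp k).concept (predName q) x ↔ A.Mem q x := by
  constructor
  · intro h
    change A.ConceptHolds (predName q) x at h
    generalize hP : predName q = P at h
    cases h with
    | pred q' x h =>
      obtain rfl : q = q' := predName_injective hP
      exact h
    | _ => simp only [predName] at hP; omega
  · exact .pred q x

theorem auxFacts : AuxFacts F Q k (A.toInterp k) := by
  constructor <;> intros <;> simp only [const_code, vertex]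
  · exact ConceptHolds.exc
  · exact RoleHolds.dead
  · exact RoleHolds.fst
  · exact RoleHolds.snd
  · exact .fn _ _ _ (.exc _)
  · exact .fn _ _ _ (.dummy _)
  · exact .pred _ _ .exc
  · exact .pred _ _ (.dummy _)
  · exact .fst_succ _ ‹_›
  · exact .snd_succ _ ‹_›
  · rename_i t ht j hj
    have h := RoleHolds.sel (A := A) t j ht hj
    split_ifs at h ⊢ <;> exact h

/-! ### The structure of an algebra as a countermodel -/

variable {A}

/-- The model of the ontology given by an algebra that satisfies the specification. -/
theorem isModel [Fintype F] [Fintype Q] {S : Spec F Q} (hA : S.Sat A)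
    (hinj : Function.Injective A.cst) :
    S.ontology.IsModel (A.toInterp S.allRules.length) := by
  have range_real : ∀ {f : F} {x y}, A.Edge f x y → Vertex.Real y := by
    rintro f x y (x | b | b)
    · exact .alg _
    · exact .dummy _
    · exact .dummy _
  refine ⟨fun τ hτ => ?_, fun α hα => ?_, ?_⟩
  · change τ ∈ S.tbox at hτ
    simp only [Spec.tbox, List.mem_append, List.mem_flatMap, List.mem_map, List.mem_cons,
      List.not_mem_nil, or_false, Finset.mem_toList, Finset.mem_univ, true_and] at hτ
    rcases hτ with ((rfl | rfl) | ⟨f, (rfl | rfl)⟩) | ⟨l, hl, rfl⟩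
    · exact fun x hx => ⟨_, A.role_status.2 (.inl ⟨A.concept_real.1 hx, rfl⟩)⟩
    · rintro x hx hx'
      have h₁ := A.concept_real.1 hx
      rw [A.concept_exc.1 hx'] at h₁
      cases h₁
    · intro x hx
      rcases A.concept_real.1 hx with x | b
      · exact ⟨_, A.role_fn.2 (.alg x)⟩
      · exact ⟨_, A.role_fn.2 (.dummy b)⟩
    · rintro y ⟨x, hx⟩
      exact A.concept_real.2 (range_real (A.role_fn.1 hx))
    · rintro y ⟨x, hx⟩
      refine A.concept_pred.2 ?_
      rcases A.role_fn.1 hx with x | b | b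
      · exact .alg _ (hA.labels l hl x)
      · exact .dummy _
      · exact .dummy _
  · rcases List.mem_append.1 hα with hα | hα
    · exact auxFacts_iff.2 A.auxFacts α hα
    · obtain ⟨φ, hφ, hα⟩ := List.mem_flatMap.1 hα
      have hφ' := hA.facts φ hφ
      rcases φ with ⟨q, a⟩ | ⟨f, a, b⟩ <;>
        simp only [Fact.toAssertions, List.mem_cons, List.not_mem_nil, or_false] at hα <;>
        rcases hα with rfl | rfl <;> simp only [Assertion.Holds, const_code]
      · exact ConceptHolds.real _ (.alg _)
      · exact ConceptHolds.pred _ _ (.alg _ hφ')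
      · exact ConceptHolds.real _ (.alg _)
      · have h : A.fn f (A.cst a) = A.cst b := hφ'
        simp only [vertex, ← h]
        exact RoleHolds.fn _ _ _ (.alg _)
  · have hcode : ∀ n ∈ S.ontology.constants, ∃ x : Name, x.code = n := by
      rintro n ⟨α, hα, hn⟩
      rcases List.mem_append.1 hα with hα | hα
      · simp only [auxAssertions, List.mem_append, List.mem_flatMap, List.mem_map, List.mem_cons,
          List.not_mem_nil, or_false, Finset.mem_toList, Finset.mem_univ, true_and,
          List.mem_range] at hα
        rcases hα with (((((rfl | rfl | rfl | rfl) | ⟨f, b, -, (rfl | rfl)⟩) |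
          ⟨q, (rfl | rfl | rfl)⟩) | ⟨t, ht, (rfl | rfl)⟩) | ⟨t, ht, j, hj, rfl⟩) <;>
          simp only [Assertion.constants, Set.mem_insert_iff, Set.mem_singleton_iff] at hn <;>
          (first | exact ⟨_, hn.symm⟩ | rcases hn with hn | hn <;> exact ⟨_, hn.symm⟩)
      · obtain ⟨φ, hφ, hα⟩ := List.mem_flatMap.1 hα
        rcases φ with ⟨q, a⟩ | ⟨f, a, b⟩ <;>
          simp only [Fact.toAssertions, List.mem_cons, List.not_mem_nil, or_false] at hα <;>
          rcases hα with rfl | rfl <;>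
          simp only [Assertion.constants, Set.mem_insert_iff, Set.mem_singleton_iff] at hn <;>
          (first | exact ⟨_, hn.symm⟩ | rcases hn with hn | hn <;> exact ⟨_, hn.symm⟩)
    intro n hn m hm h
    obtain ⟨x, rfl⟩ := hcode n hn
    obtain ⟨y, rfl⟩ := hcode m hm
    simp only [const_code] at h
    congr 1
    rcases x with a | _ | b | _ | _ | t <;> rcases y with a' | _ | b' | _ | _ | t' <;> try cases h
    · rw [hinj (Vertex.alg.inj h)]
    all_goals rfl

theorem pathAtoms_alg {g : Var → (A.toInterp k).Dom} {i : ℕ} {x : A.Carrier}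
    (hx : g (.root i) = Vertex.alg x) {b : Bool} {w : List F}
    (h : ∀ α ∈ pathAtoms i b w, α.Holds (A.toInterp k) g) :
    g (node i b w) = Vertex.alg (A.run w x) := by
  induction w with
  | nil => exact hx
  | cons f w ih =>
    have hw := ih fun α hα => h α (List.mem_cons_of_mem _ hα)
    have hf := A.role_fn.1 (h _ List.mem_cons_self)
    rw [hw] at hf
    generalize g (node i b (f :: w)) = y at hf ⊢
    cases hf
    rfl

/-- The dummies are live too, as the range inclusions force them into the carrier. They break no
rule because every function fixes them. -/
theorem pathAtoms_dummy {g : Var → (A.toInterp k).Dom} {i : ℕ} {d : Bool}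
    (hx : g (.root i) = Vertex.dummy d) {b : Bool} {w : List F}
    (h : ∀ α ∈ pathAtoms i b w, α.Holds (A.toInterp k) g) :
    g (node i b w) = Vertex.dummy d := by
  induction w with
  | nil => exact hx
  | cons f w ih =>
    have hw := ih fun α hα => h α (List.mem_cons_of_mem _ hα)
    have hf := A.role_fn.1 (h _ List.mem_cons_self)
    rw [hw] at hf
    generalize g (node i b (f :: w)) = y at hf ⊢
    cases hf
    rfl

/-- The structure of an algebra that satisfies the specification refutes the query. -/
theorem not_query [Fintype F] [Fintype Q] {S : Spec F Q} (hA : S.Sat A) :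
    ¬ S.query.Holds (A.toInterp S.allRules.length) := by
  rw [Spec.query_holds]
  rintro ⟨g, hg⟩
  simp only [Spec.vatoms, List.mem_append, List.mem_flatMap, List.mem_finRange, true_and,
    List.mem_cons, List.not_mem_nil, or_false] at hg
  have h₁ := A.role_fst.1 (hg (.role 1 .hub .fst) (by simp))
  have h₂ := A.role_snd.1 (hg (.role 2 .hub .snd) (by simp))
  have h₃ := A.role_status.1 (hg (.role 0 .src .tgt) (by simp))
  have h₄ : g .tgt ≠ g .fst := hg (.ne .tgt .fst) (by simp)
  have h₅ : g .src ≠ g .snd := hg (.ne .src .snd) (by simp)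
  have hr : ∀ i : Fin S.allRules.length, ∀ α ∈ ruleAtoms i (S.allRules.get i),
      α.Holds _ g := fun i α hα => hg α (.inr ⟨i, hα⟩)
  have hsel : ∀ i : Fin S.allRules.length, ∃ t < S.allRules.length + 1, (i : ℕ) < _ ∧
      g .hub = .hub t ∧ g (.status i) = if t = i + 1 then .live else .dead := fun i =>
    A.role_sel.1 (hr i (.role (selName i) .hub (.status i)) (by simp [ruleAtoms]))
  rcases h₁ with ⟨hh, hf⟩ | ⟨t, ht, hh, hf⟩
  · rcases h₃ with ⟨-, h₃⟩ | ⟨h₃, -⟩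
    · exact h₄ (h₃.trans hf.symm)
    · rcases h₂ with ⟨-, hs⟩ | ⟨t, -, hh', -⟩
      · exact h₅ (h₃.trans hs.symm)
      · cases hh.symm.trans hh'
  -- At `hub (t + 1)` the status of rule `t` is live, so its root is an algebra element or a dummy,
  -- never `exc`.
  · set i : Fin S.allRules.length := ⟨t, ht⟩ with hi
    obtain ⟨t', -, -, hh', hst⟩ := hsel i
    obtain rfl : t + 1 = t' := Vertex.hub.inj (hh.symm.trans hh')
    rw [if_pos rfl] at hst
    have hroot := A.role_status.1 (hr i (.role 0 (.root i) (.status i)) (by simp [ruleAtoms]))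
    rw [hst] at hroot
    have hne : g (node i false (S.allRules.get i).lhs) ≠ g (node i true (S.allRules.get i).rhs) :=
      hr i (.ne _ _) (by simp [ruleAtoms])
    have hl : ∀ α ∈ pathAtoms i false (S.allRules.get i).lhs, α.Holds _ g := fun α hα =>
      hr i α (by simp only [ruleAtoms, List.mem_append]; exact .inl (.inl (.inr hα)))
    have hrh : ∀ α ∈ pathAtoms i true (S.allRules.get i).rhs, α.Holds _ g := fun α hα =>
      hr i α (by simp only [ruleAtoms, List.mem_append]; exact .inl (.inr hα))
    have hc : ∀ c ∈ (S.allRules.get i).conds,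
        ∀ α ∈ VAtom.concept (predName c.2) (node i true c.1) :: pathAtoms i true c.1,
        α.Holds _ g := fun c hc α hα =>
      hr i α (by
        simp only [ruleAtoms, List.mem_append, List.mem_flatMap]
        exact .inr ⟨c, hc, hα⟩)
    rcases hroot with ⟨hreal, -⟩ | ⟨-, h⟩
    · generalize hx : g (.root i) = x at hreal
      rcases hreal with x | d
      · have hrule : (S.allRules.get i).Holds A := by
          rcases List.mem_append.1 (List.get_mem S.allRules i) with h | h
          · obtain ⟨f, -, h⟩ := List.mem_map.1 h
            rw [← h]
            exact fun _ _ => rfl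
          · exact hA.rules _ h
        refine hne ?_
        rw [pathAtoms_alg hx hl, pathAtoms_alg hx hrh, hrule x fun c hcm => ?_]
        have h := A.concept_pred.1 (hc c hcm _ List.mem_cons_self)
        rw [pathAtoms_alg hx fun α hα => hc c hcm α (List.mem_cons_of_mem _ hα)] at h
        cases h
        assumption
      · exact hne ((pathAtoms_dummy hx hl).trans (pathAtoms_dummy hx hrh).symm)
    · cases h

end UnaryAlgebra

end DLLite

namespace DLLite

open Turing.ToPartrec (Code)

/-! ### Evaluation of programs, specified by unary algebras

A call has a program, an argument and a result, and at most two calls on which it depends; `new` is a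
list that the call constructs, and `cst` is a constant of the program. The label `dfn` distinguishes
the defined lists. -/

inductive Op where
  | suc | pre | hd | tl | code | left | right | cst | sub₁ | sub₂ | arg | res | new
  deriving DecidableEq, Encodable

instance : Fintype Op where
  elems := {.suc, .pre, .hd, .tl, .code, .left, .right, .cst, .sub₁, .sub₂, .arg, .res, .new}
  complete x := by cases x <;> simp

inductive Lab where
  | zero | pos | dfn | isZero | isSucc | isTail | isCons | isComp | isCase | isFix
  deriving DecidableEq, Encodable

instance : Fintype Lab where
  elems := {.zero, .pos, .dfn, .isZero, .isSucc, .isTail, .isCons, .isComp, .isCase, .isFix}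
  complete x := by cases x <;> simp

open Op Lab

/-- The values of `tl` and `new` are always labelled `dfn`. Rules that use them are therefore
guarded by definedness of the relevant argument or results, so that an undefined call does not
acquire a defined result. The `comp` rules need no guard, as undefinedness passes through them
unchanged. -/
def evalRules : List (Rule Op Lab) := [
  ⟨[], [pre, suc], []⟩,
  ⟨[], [code, sub₁], [left, code]⟩,
  ⟨[], [code, sub₂], [right, code]⟩,
  ⟨[([code], isZero), ([arg], dfn)], [res], [new]⟩,
  ⟨[([code], isZero), ([arg], dfn)], [hd, new], [cst, code]⟩,
  ⟨[([code], isZero), ([arg], dfn)], [tl, new], [arg]⟩,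
  ⟨[([code], isSucc), ([arg], dfn)], [res], [new]⟩,
  ⟨[([code], isSucc), ([arg], dfn)], [hd, new], [suc, hd, arg]⟩,
  ⟨[([code], isSucc), ([arg], dfn)], [tl, new], [cst, code]⟩,
  ⟨[([code], isTail), ([arg], dfn)], [res], [tl, arg]⟩,
  ⟨[([code], isCons)], [arg, sub₁], [arg]⟩,
  ⟨[([code], isCons)], [arg, sub₂], [arg]⟩,
  ⟨[([code], isCons), ([res, sub₁], dfn), ([res, sub₂], dfn)], [res], [new]⟩,
  ⟨[([code], isCons), ([res, sub₁], dfn), ([res, sub₂], dfn)], [hd, new], [hd, res, sub₁]⟩,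
  ⟨[([code], isCons), ([res, sub₁], dfn), ([res, sub₂], dfn)], [tl, new], [res, sub₂]⟩,
  ⟨[([code], isComp)], [arg, sub₁], [arg]⟩,
  ⟨[([code], isComp)], [arg, sub₂], [res, sub₁]⟩,
  ⟨[([code], isComp)], [res], [res, sub₂]⟩,
  ⟨[([code], isCase), ([arg], dfn)], [arg, sub₁], [tl, arg]⟩,
  ⟨[([code], isCase), ([arg], dfn), ([hd, arg], zero)], [res], [res, sub₁]⟩,
  ⟨[([code], isCase), ([arg], dfn), ([hd, arg], pos)], [arg, sub₂], [new]⟩,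
  ⟨[([code], isCase), ([arg], dfn), ([hd, arg], pos)], [hd, new], [pre, hd, arg]⟩,
  ⟨[([code], isCase), ([arg], dfn), ([hd, arg], pos)], [tl, new], [tl, arg]⟩,
  ⟨[([code], isCase), ([arg], dfn), ([hd, arg], pos)], [res], [res, sub₂]⟩,
  ⟨[([code], isFix)], [arg, sub₁], [arg]⟩,
  ⟨[([code], isFix), ([res, sub₁], dfn), ([hd, res, sub₁], zero)], [res], [tl, res, sub₁]⟩,
  ⟨[([code], isFix), ([res, sub₁], dfn), ([hd, res, sub₁], pos)], [arg, sub₂], [tl, res, sub₁]⟩,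
  ⟨[([code], isFix), ([res, sub₁], dfn), ([hd, res, sub₁], pos)], [res], [res, sub₂]⟩]

/-- The equations `evalRules`, spelt out. -/
structure EvalLaws (A : UnaryAlgebra.{u} Op Lab) : Prop where
  pre_suc : ∀ x, A.fn pre (A.fn suc x) = x
  code_sub₁ : ∀ x, A.fn code (A.fn sub₁ x) = A.fn left (A.fn code x)
  code_sub₂ : ∀ x, A.fn code (A.fn sub₂ x) = A.fn right (A.fn code x)
  zero_res : ∀ x, A.pred isZero (A.fn code x) → A.pred dfn (A.fn arg x) →
    A.fn res x = A.fn new x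
  zero_hd : ∀ x, A.pred isZero (A.fn code x) → A.pred dfn (A.fn arg x) →
    A.fn hd (A.fn new x) = A.fn cst (A.fn code x)
  zero_tl : ∀ x, A.pred isZero (A.fn code x) → A.pred dfn (A.fn arg x) →
    A.fn tl (A.fn new x) = A.fn arg x
  succ_res : ∀ x, A.pred isSucc (A.fn code x) → A.pred dfn (A.fn arg x) →
    A.fn res x = A.fn new x
  succ_hd : ∀ x, A.pred isSucc (A.fn code x) → A.pred dfn (A.fn arg x) →
    A.fn hd (A.fn new x) = A.fn suc (A.fn hd (A.fn arg x))
  succ_tl : ∀ x, A.pred isSucc (A.fn code x) → A.pred dfn (A.fn arg x) →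
    A.fn tl (A.fn new x) = A.fn cst (A.fn code x)
  tail_res : ∀ x, A.pred isTail (A.fn code x) → A.pred dfn (A.fn arg x) →
    A.fn res x = A.fn tl (A.fn arg x)
  cons_arg₁ : ∀ x, A.pred isCons (A.fn code x) → A.fn arg (A.fn sub₁ x) = A.fn arg x
  cons_arg₂ : ∀ x, A.pred isCons (A.fn code x) → A.fn arg (A.fn sub₂ x) = A.fn arg x
  cons_res : ∀ x, A.pred isCons (A.fn code x) → A.pred dfn (A.fn res (A.fn sub₁ x)) →
    A.pred dfn (A.fn res (A.fn sub₂ x)) → A.fn res x = A.fn new x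
  cons_hd : ∀ x, A.pred isCons (A.fn code x) → A.pred dfn (A.fn res (A.fn sub₁ x)) →
    A.pred dfn (A.fn res (A.fn sub₂ x)) →
    A.fn hd (A.fn new x) = A.fn hd (A.fn res (A.fn sub₁ x))
  cons_tl : ∀ x, A.pred isCons (A.fn code x) → A.pred dfn (A.fn res (A.fn sub₁ x)) →
    A.pred dfn (A.fn res (A.fn sub₂ x)) → A.fn tl (A.fn new x) = A.fn res (A.fn sub₂ x)
  comp_arg₁ : ∀ x, A.pred isComp (A.fn code x) → A.fn arg (A.fn sub₁ x) = A.fn arg x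
  comp_arg₂ : ∀ x, A.pred isComp (A.fn code x) →
    A.fn arg (A.fn sub₂ x) = A.fn res (A.fn sub₁ x)
  comp_res : ∀ x, A.pred isComp (A.fn code x) → A.fn res x = A.fn res (A.fn sub₂ x)
  case_arg₁ : ∀ x, A.pred isCase (A.fn code x) → A.pred dfn (A.fn arg x) →
    A.fn arg (A.fn sub₁ x) = A.fn tl (A.fn arg x)
  case_res_zero : ∀ x, A.pred isCase (A.fn code x) → A.pred dfn (A.fn arg x) →
    A.pred zero (A.fn hd (A.fn arg x)) → A.fn res x = A.fn res (A.fn sub₁ x)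
  case_arg₂ : ∀ x, A.pred isCase (A.fn code x) → A.pred dfn (A.fn arg x) →
    A.pred pos (A.fn hd (A.fn arg x)) → A.fn arg (A.fn sub₂ x) = A.fn new x
  case_hd : ∀ x, A.pred isCase (A.fn code x) → A.pred dfn (A.fn arg x) →
    A.pred pos (A.fn hd (A.fn arg x)) → A.fn hd (A.fn new x) = A.fn pre (A.fn hd (A.fn arg x))
  case_tl : ∀ x, A.pred isCase (A.fn code x) → A.pred dfn (A.fn arg x) →
    A.pred pos (A.fn hd (A.fn arg x)) → A.fn tl (A.fn new x) = A.fn tl (A.fn arg x)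
  case_res_pos : ∀ x, A.pred isCase (A.fn code x) → A.pred dfn (A.fn arg x) →
    A.pred pos (A.fn hd (A.fn arg x)) → A.fn res x = A.fn res (A.fn sub₂ x)
  fix_arg₁ : ∀ x, A.pred isFix (A.fn code x) → A.fn arg (A.fn sub₁ x) = A.fn arg x
  fix_res_zero : ∀ x, A.pred isFix (A.fn code x) → A.pred dfn (A.fn res (A.fn sub₁ x)) →
    A.pred zero (A.fn hd (A.fn res (A.fn sub₁ x))) →
    A.fn res x = A.fn tl (A.fn res (A.fn sub₁ x))
  fix_arg₂ : ∀ x, A.pred isFix (A.fn code x) → A.pred dfn (A.fn res (A.fn sub₁ x)) →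
    A.pred pos (A.fn hd (A.fn res (A.fn sub₁ x))) →
    A.fn arg (A.fn sub₂ x) = A.fn tl (A.fn res (A.fn sub₁ x))
  fix_res_pos : ∀ x, A.pred isFix (A.fn code x) → A.pred dfn (A.fn res (A.fn sub₁ x)) →
    A.pred pos (A.fn hd (A.fn res (A.fn sub₁ x))) → A.fn res x = A.fn res (A.fn sub₂ x)

theorem evalLaws_iff {A : UnaryAlgebra.{u} Op Lab} :
    (∀ ρ ∈ evalRules, ρ.Holds A) ↔ EvalLaws A := by
  simp only [evalRules, List.forall_mem_cons, Rule.Holds, UnaryAlgebra.run_cons,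
    UnaryAlgebra.run_nil, List.not_mem_nil, IsEmpty.forall_iff, implies_true, and_imp, and_true,
    forall_const]
  constructor
  · rintro ⟨h₁, h₂, h₃, h₄, h₅, h₆, h₇, h₈, h₉, h₁₀, h₁₁, h₁₂, h₁₃, h₁₄, h₁₅, h₁₆, h₁₇, h₁₈, h₁₉,
      h₂₀, h₂₁, h₂₂, h₂₃, h₂₄, h₂₅, h₂₆, h₂₇, h₂₈⟩
    constructor <;> assumption
  · rintro ⟨⟩
    and_intros <;> assumption

/-- A numbering of the programs. -/
def codeNum : Code → ℕ
  | .zero' => 0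
  | .succ => 1
  | .tail => 2
  | .cons f g => 4 * Nat.pair (codeNum f) (codeNum g) + 3
  | .comp f g => 4 * Nat.pair (codeNum f) (codeNum g) + 4
  | .case f g => 4 * Nat.pair (codeNum f) (codeNum g) + 5
  | .fix f => 4 * codeNum f + 6

theorem codeNum_injective : Function.Injective codeNum := by
  intro c
  induction c with
  | zero' | succ | tail =>
    intro d h
    cases d <;> simp only [codeNum] at h <;> first | rfl | omega
  | cons f g hf hg | comp f g hf hg | case f g hf hg =>
    intro d h
    cases d <;> simp only [codeNum] at h <;> try omega
    rename_i f' g'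
    have h' := Nat.pair_eq_pair.1 (show Nat.pair (codeNum f) (codeNum g) =
      Nat.pair (codeNum f') (codeNum g') by omega)
    rw [hf h'.1, hg h'.2]
  | fix f hf =>
    intro d h
    cases d <;> simp only [codeNum] at h <;> try omega
    rename_i f'
    rw [hf (show codeNum f = codeNum f' by omega)]

/-- The constants for numbers, for programs, and (below `4`) for the output, the empty list, the input
and the initial call. -/
def numCst (k : ℕ) : ℕ := 2 * k + 4

def codeCst (c : Code) : ℕ := 2 * codeNum c + 5

/-- The facts about a program and its parts. -/
def codeFacts : Code → List (Fact Op Lab)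
  | .zero' => [.pred isZero (codeCst .zero'), .app cst (codeCst .zero') (numCst 0)]
  | .succ => [.pred isSucc (codeCst .succ), .app cst (codeCst .succ) 1]
  | .tail => [.pred isTail (codeCst .tail)]
  | .cons f g => .pred isCons (codeCst (.cons f g)) ::
      .app left (codeCst (.cons f g)) (codeCst f) ::
      .app right (codeCst (.cons f g)) (codeCst g) :: (codeFacts f ++ codeFacts g)
  -- The first subcall runs the left part, and composition evaluates `g` first.
  | .comp f g => .pred isComp (codeCst (.comp f g)) ::
      .app left (codeCst (.comp f g)) (codeCst g) ::
      .app right (codeCst (.comp f g)) (codeCst f) :: (codeFacts f ++ codeFacts g)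
  | .case f g => .pred isCase (codeCst (.case f g)) ::
      .app left (codeCst (.case f g)) (codeCst f) ::
      .app right (codeCst (.case f g)) (codeCst g) :: (codeFacts f ++ codeFacts g)
  -- The right part is the program itself, so unbounded iteration uses finitely many program
  -- constants.
  | .fix f => .pred isFix (codeCst (.fix f)) ::
      .app left (codeCst (.fix f)) (codeCst f) ::
      .app right (codeCst (.fix f)) (codeCst (.fix f)) :: codeFacts f

def baseFacts (c : Code) : List (Fact Op Lab) :=
  [.pred zero (numCst 0), .app hd 0 0, .app hd 1 (numCst 0), .app tl 1 1, .app tl 2 1, .pred dfn 2,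
    .app code 3 (codeCst c), .app arg 3 2, .app res 3 0]

def inputFacts (n : ℕ) : List (Fact Op Lab) :=
  .app hd 2 (numCst n) :: (List.range n).map fun k => .app suc (numCst k) (numCst (k + 1))

/-- The specification of the run of the program `c` on the input `[n]`. The head of the output is
the output itself, and hence not zero. -/
def evalSpec (c : Code) (n : ℕ) : Spec Op Lab where
  rules := evalRules
  labels := [(suc, pos), (tl, dfn), (new, dfn)]
  facts := codeFacts c ++ baseFacts c ++ inputFacts n

theorem lhs_ne_nil_of_mem_evalRules : ∀ ρ ∈ evalRules, ρ.lhs ≠ [] := by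
  simp [evalRules]

/-! ### Terminating programs -/

namespace UnaryAlgebra

variable (A : UnaryAlgebra.{u} Op Lab)

def num (k : ℕ) : A.Carrier := (A.fn suc)^[k] (A.cst (numCst 0))

/-- `x` represents the list `v`, which is padded with zeros. -/
def Represents (x : A.Carrier) (v : List ℕ) : Prop :=
  ∀ i, A.fn hd ((A.fn tl)^[i] x) = A.num (v.drop i).headI

variable {A}

theorem Represents.hd {x : A.Carrier} {v : List ℕ} (h : A.Represents x v) :
    A.fn hd x = A.num v.headI := h 0

theorem Represents.tl {x : A.Carrier} {v : List ℕ} (h : A.Represents x v) :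
    A.Represents (A.fn tl x) v.tail := fun i => by
  simpa using h (i + 1)

theorem Represents.mk {x : A.Carrier} {v : List ℕ} (h : A.fn Op.hd x = A.num v.headI)
    (h' : A.Represents (A.fn Op.tl x) v.tail) : A.Represents x v
  | 0 => h
  | i + 1 => by simpa using h' i

theorem num_succ (k : ℕ) : A.num (k + 1) = A.fn suc (A.num k) :=
  Function.iterate_succ_apply' _ _ _

/-- The rules are only used to derive facts along the actual computation. Accidental identifications
in the algebra, such as coinciding numbers, do no harm. -/
theorem represents_res {c₀ : Code} {n : ℕ} (hA : (evalSpec c₀ n).Sat A) {c : Code}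
    (hc : ∀ φ ∈ codeFacts c, φ.Holds A) {x : A.Carrier} {v w : List ℕ}
    (hx : A.fn code x = A.cst (codeCst c)) (hd : A.pred dfn (A.fn arg x))
    (hv : A.Represents (A.fn arg x) v) (hw : w ∈ c.eval v) :
    A.pred dfn (A.fn res x) ∧ A.Represents (A.fn res x) w := by
  have L := evalLaws_iff.1 hA.rules
  have hpos : ∀ x, A.pred pos (A.fn suc x) := hA.labels (suc, pos) (by simp [evalSpec])
  have hdtl : ∀ x, A.pred dfn (A.fn tl x) := hA.labels (tl, dfn) (by simp [evalSpec])
  have hdnew : ∀ x, A.pred dfn (A.fn new x) := hA.labels (new, dfn) (by simp [evalSpec])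
  have hbase : ∀ φ ∈ baseFacts c₀, φ.Holds A := fun φ hφ =>
    hA.facts φ (by simp [evalSpec, hφ])
  have hzero : A.pred zero (A.num 0) := hbase (.pred zero (numCst 0)) (by simp [baseFacts])
  have hnil : A.Represents (A.cst 1) [] := by
    have h₁ : A.fn Op.hd (A.cst 1) = A.num 0 := hbase (.app Op.hd 1 (numCst 0)) (by simp [baseFacts])
    have h₂ : A.fn Op.tl (A.cst 1) = A.cst 1 := hbase (.app tl 1 1) (by simp [baseFacts])
    intro i
    rw [Function.iterate_fixed h₂, h₁]
    simp
  induction c generalizing x v w with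
  | zero' =>
    simp only [codeFacts, List.forall_mem_cons, Fact.Holds] at hc
    rw [← hx] at hc
    simp only [Code.zero'_eval, Part.pure_eq_some, Part.mem_some_iff] at hw
    subst hw
    rw [L.zero_res x hc.1 hd]
    refine ⟨hdnew x, .mk ?_ ?_⟩
    · rw [L.zero_hd x hc.1 hd, hc.2.1]
      rfl
    · rwa [L.zero_tl x hc.1 hd]
  | succ =>
    simp only [codeFacts, List.forall_mem_cons, Fact.Holds] at hc
    rw [← hx] at hc
    simp only [Code.succ_eval, Part.pure_eq_some, Part.mem_some_iff] at hw
    subst hw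
    rw [L.succ_res x hc.1 hd]
    refine ⟨hdnew x, .mk ?_ ?_⟩
    · rw [L.succ_hd x hc.1 hd, hv.hd, ← num_succ]
      rfl
    · rw [L.succ_tl x hc.1 hd, hc.2.1]
      exact hnil
  | tail =>
    simp only [codeFacts, List.forall_mem_cons, Fact.Holds] at hc
    rw [← hx] at hc
    simp only [Code.tail_eval, Part.pure_eq_some, Part.mem_some_iff] at hw
    subst hw
    rw [L.tail_res x hc.1 hd]
    exact ⟨hdtl _, hv.tl⟩
  | cons f g ihf ihg =>
    simp only [codeFacts, List.forall_mem_cons, List.forall_mem_append, Fact.Holds] at hc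
    rw [← hx] at hc
    obtain ⟨hk, hl, hr, hf, hg⟩ := hc
    simp only [Code.cons_eval, Part.pure_eq_some, Part.bind_eq_bind, Part.mem_bind_iff,
      Part.mem_some_iff] at hw
    obtain ⟨w₁, hw₁, w₂, hw₂, rfl⟩ := hw
    obtain ⟨d₁, r₁⟩ := ihf hf (x := A.fn sub₁ x) ((L.code_sub₁ x).trans hl)
      (by rwa [L.cons_arg₁ x hk]) (by rwa [L.cons_arg₁ x hk]) hw₁
    obtain ⟨d₂, r₂⟩ := ihg hg (x := A.fn sub₂ x) ((L.code_sub₂ x).trans hr)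
      (by rwa [L.cons_arg₂ x hk]) (by rwa [L.cons_arg₂ x hk]) hw₂
    rw [L.cons_res x hk d₁ d₂]
    refine ⟨hdnew x, .mk ?_ ?_⟩
    · rw [L.cons_hd x hk d₁ d₂, r₁.hd]
      rfl
    · rwa [L.cons_tl x hk d₁ d₂]
  | comp f g ihf ihg =>
    simp only [codeFacts, List.forall_mem_cons, List.forall_mem_append, Fact.Holds] at hc
    rw [← hx] at hc
    obtain ⟨hk, hl, hr, hf, hg⟩ := hc
    rw [Code.comp_eval] at hw
    obtain ⟨w₁, hw₁, hw₂⟩ := Part.mem_bind_iff.1 hw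
    obtain ⟨d₁, r₁⟩ := ihg hg (x := A.fn sub₁ x) ((L.code_sub₁ x).trans hl)
      (by rwa [L.comp_arg₁ x hk]) (by rwa [L.comp_arg₁ x hk]) hw₁
    rw [L.comp_res x hk]
    exact ihf hf ((L.code_sub₂ x).trans hr) (by rwa [L.comp_arg₂ x hk])
      (by rwa [L.comp_arg₂ x hk]) hw₂
  | case f g ihf ihg =>
    simp only [codeFacts, List.forall_mem_cons, List.forall_mem_append, Fact.Holds] at hc
    rw [← hx] at hc
    obtain ⟨hk, hl, hr, hf, hg⟩ := hc
    simp only [Code.case_eval] at hw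
    have hhd := hv.hd
    rcases hn : v.headI with _ | y <;> rw [hn] at hw hhd
    · rw [L.case_res_zero x hk hd (by rwa [hhd])]
      exact ihf hf ((L.code_sub₁ x).trans hl) (by rw [L.case_arg₁ x hk hd]; exact hdtl _)
        (by rw [L.case_arg₁ x hk hd]; exact hv.tl) hw
    · have hp : A.pred pos (A.fn Op.hd (A.fn arg x)) := by
        rw [hhd, num_succ]
        exact hpos _
      rw [L.case_res_pos x hk hd hp]
      refine ihg hg ((L.code_sub₂ x).trans hr) (by rw [L.case_arg₂ x hk hd hp]; exact hdnew _)
        ?_ hw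
      rw [L.case_arg₂ x hk hd hp]
      refine .mk ?_ ?_
      · rw [L.case_hd x hk hd hp, hhd, num_succ, L.pre_suc]
        rfl
      · rw [L.case_tl x hk hd hp]
        exact hv.tl
  | fix f ihf =>
    simp only [codeFacts, List.forall_mem_cons, Fact.Holds] at hc
    obtain ⟨hk, hl, hr, hf⟩ := hc
    rw [Code.fix_eval] at hw
    revert x
    -- Structural induction covers the body `f`; the repeated call of `fix f` needs an inner
    -- induction along its terminating iteration.
    refine PFun.fixInduction (C := fun v => ∀ {x}, A.fn code x = A.cst (codeCst (.fix f)) →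
      A.pred dfn (A.fn arg x) → A.Represents (A.fn arg x) v →
      A.pred dfn (A.fn res x) ∧ A.Represents (A.fn res x) w) hw fun v hw ih x hx hd hv => ?_
    rw [← hx] at hk hl hr
    replace hw := PFun.mem_fix_iff.1 hw
    have sub : ∀ w₁ ∈ f.eval v, A.pred dfn (A.fn res (A.fn sub₁ x)) ∧
        A.Represents (A.fn res (A.fn sub₁ x)) w₁ := fun w₁ h₁ =>
      ihf hf ((L.code_sub₁ x).trans hl) (by rwa [L.fix_arg₁ x hk]) (by rwa [L.fix_arg₁ x hk]) h₁
    simp only [Part.mem_map_iff] at hw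
    rcases hw with ⟨w₁, h₁, hw⟩ | ⟨v', ⟨w₁, h₁, hw⟩, -⟩
    · obtain ⟨d₁, r₁⟩ := sub w₁ h₁
      split_ifs at hw with h₀
      obtain rfl := Sum.inl.inj hw
      rw [L.fix_res_zero x hk d₁ (by rwa [r₁.hd, h₀])]
      exact ⟨hdtl _, r₁.tl⟩
    · obtain ⟨d₁, r₁⟩ := sub w₁ h₁
      have hmem : Sum.inr v' ∈ (f.eval v).map fun v =>
          if v.headI = 0 then Sum.inl v.tail else Sum.inr v.tail := Part.mem_map_iff _ |>.2 ⟨w₁, h₁, hw⟩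
      split_ifs at hw with h₀
      obtain rfl := Sum.inr.inj hw
      have hp : A.pred pos (A.fn Op.hd (A.fn res (A.fn sub₁ x))) := by
        obtain ⟨y, hy⟩ := Nat.exists_eq_succ_of_ne_zero h₀
        rw [r₁.hd, hy, Nat.succ_eq_add_one, num_succ]
        exact hpos _
      rw [L.fix_res_pos x hk d₁ hp]
      have ha := L.fix_arg₂ x hk d₁ hp
      exact ih _ hmem ((L.code_sub₂ x).trans (hr.trans hx)) (by rw [ha]; exact hdtl _) (by rw [ha]; exact r₁.tl)

/-- A program with output zero has no algebra. -/
theorem not_sat_of_eval {c : Code} {n : ℕ} (h : [0] ∈ c.eval [n]) : ¬ (evalSpec c n).Sat A := by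
  intro hA
  have hbase : ∀ φ ∈ baseFacts c, φ.Holds A := fun φ hφ =>
    hA.facts φ (by simp [evalSpec, hφ])
  have hinput : ∀ φ ∈ inputFacts n, φ.Holds A := fun φ hφ =>
    hA.facts φ (by simp [evalSpec, hφ])
  simp only [baseFacts, List.forall_mem_cons, Fact.Holds] at hbase
  obtain ⟨-, hout, hnil, hnil', hinp, hdfn, hcode, harg, hres, -⟩ := hbase
  have hnum : ∀ k ≤ n, A.num k = A.cst (numCst k) := by
    intro k hk
    induction k with
    | zero => rfl
    | succ k ih =>
      rw [num_succ, ih (by omega)]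
      exact hinput (.app suc (numCst k) (numCst (k + 1)))
        (List.mem_cons_of_mem _ (List.mem_map.2 ⟨k, List.mem_range.2 hk, rfl⟩))
  have hrep : A.Represents (A.cst 2) [n] := by
    refine .mk ((hinput (.app hd 2 (numCst n)) List.mem_cons_self).trans (hnum n le_rfl).symm) ?_
    rw [hinp]
    intro i
    rw [Function.iterate_fixed hnil', hnil]
    simp [num]
  have := (represents_res hA (fun φ hφ => hA.facts φ (by simp [evalSpec, hφ])) hcode
    (by rwa [harg]) (by rwa [harg]) h).2.hd
  rw [hres, hout] at this
  -- The output is its own head and that head is zero, contradicting the distinctness of the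
  -- constants `0` and `numCst 0`.
  have := hA.inj (x₁ := 0) (x₂ := numCst 0) ⟨.app hd 0 0, by simp [evalSpec, baseFacts], .inl rfl⟩
    ⟨.pred zero (numCst 0), by simp [evalSpec, baseFacts], rfl⟩ this
  simp [numCst] at this

end UnaryAlgebra

end DLLite

namespace DLLite

open Turing.ToPartrec (Code)
open Op Lab

/-! ### Diverging programs -/

/-- The standard vertices; the argument of a call may be undefined. -/
inductive Elem : Type u where
  | bot
  | num (k : ℕ)
  | list (v : List ℕ)
  | code (j : ℕ)
  | call (c : Code) (o : Part (List ℕ))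

namespace Elem

open Classical in
noncomputable def ofPart (o : Part (List ℕ)) : Elem.{u} :=
  if h : o.Dom then .list (o.get h) else .bot

@[simp] theorem ofPart_none : ofPart Part.none = .bot := by simp [ofPart]

@[simp] theorem ofPart_some (v : List ℕ) : ofPart (Part.some v) = .list v := by simp [ofPart]

open Classical in
/-- The value of a partial list, with the empty list as default. -/
noncomputable def total (o : Part (List ℕ)) : List ℕ := o.getOrElse []

@[simp] theorem total_some (v : List ℕ) : total (Part.some v) = v := by simp [total]

noncomputable def decodeNum : ℕ → Option Code := Function.partialInv codeNum

@[simp] theorem decodeNum_codeNum (c : Code) : decodeNum (codeNum c) = some c :=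
  Function.partialInv_left codeNum_injective c

def leftPart : Option Code → Elem.{u}
  | some (.cons f _) => .code (codeNum f)
  | some (.comp _ g) => .code (codeNum g)
  | some (.case f _) => .code (codeNum f)
  | some (.fix f) => .code (codeNum f)
  | _ => .bot

def rightPart : Option Code → Elem.{u}
  | some (.cons _ g) => .code (codeNum g)
  | some (.comp f _) => .code (codeNum f)
  | some (.case _ g) => .code (codeNum g)
  | some (.fix f) => .code (codeNum (.fix f))
  | _ => .bot

def constPart : Option Code → Elem.{u}
  | some .zero' => .num 0
  | some .succ => .list []
  | _ => .bot

/-- The argument of the recursive call of `case` at a positive number. -/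
def predHead (v : List ℕ) : Part (List ℕ) :=
  match v.headI with
  | 0 => Part.none
  | y + 1 => Part.some (y :: v.tail)

/-- Evaluation as a total function into partial lists. -/
def evalPart (c : Code) (v : List ℕ) : Part (List ℕ) := c.eval v

@[simp] theorem evalPart_zero' : evalPart .zero' = fun v => Part.some (0 :: v) := rfl

@[simp] theorem evalPart_succ : evalPart .succ = fun v => Part.some [v.headI + 1] := rfl

@[simp] theorem evalPart_tail : evalPart .tail = fun v => Part.some v.tail := rfl

theorem evalPart_cons (f g : Code) : evalPart (.cons f g) = fun v =>
    (evalPart f v).bind fun n => (evalPart g v).bind fun ns => Part.some (n.headI :: ns) := rfl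

theorem evalPart_comp (f g : Code) :
    evalPart (.comp f g) = fun v => (evalPart g v).bind (evalPart f) := rfl

theorem evalPart_case_zero {f g : Code} {v : List ℕ} (h : v.headI = 0) :
    evalPart (.case f g) v = evalPart f v.tail := by
  simp [evalPart, h]

theorem evalPart_case_succ {f g : Code} {v : List ℕ} {y : ℕ} (h : v.headI = y + 1) :
    evalPart (.case f g) v = evalPart g (y :: v.tail) := by
  simp [evalPart, h]

theorem evalPart_fix {f : Code} {v w : List ℕ} (h : evalPart f v = Part.some w) :
    evalPart (.fix f) v = if w.headI = 0 then Part.some w.tail else evalPart (.fix f) w.tail := by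
  replace h : f.eval v = Part.some w := h
  simp only [evalPart, Code.fix_eval]
  split_ifs with h₀
  · refine Part.eq_some_iff.2 (PFun.fix_stop ?_)
    simp [h, h₀]
  · refine PFun.fix_fwd_eq ?_
    simp [h, h₀]

/-- Calls keep a partial argument, so subcalls of undefined calls are again calls and the unguarded
rules hold. The defaults of `tl` and `new` are `list []`, as their labels forbid `bot`; `suc` fixes
non-numbers so that `pre` inverts it everywhere. -/
noncomputable def fn : Op → Elem.{u} → Elem.{u}
  | .suc, .num k => .num (k + 1)
  | .suc, x => x
  | .pre, .num k => .num (k - 1)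
  | .pre, x => x
  | .hd, .list v => .num v.headI
  | .hd, _ => .bot
  | .tl, .list v => .list v.tail
  | .tl, _ => .list []
  | .code, .call c _ => .code (codeNum c)
  | .code, _ => .bot
  | .left, .code j => leftPart (decodeNum j)
  | .left, _ => .bot
  | .right, .code j => rightPart (decodeNum j)
  | .right, _ => .bot
  | .cst, .code j => constPart (decodeNum j)
  | .cst, _ => .bot
  | .sub₁, .call (.cons f _) o => .call f o
  | .sub₁, .call (.comp _ g) o => .call g o
  | .sub₁, .call (.case f _) o => .call f (o.map List.tail)
  | .sub₁, .call (.fix f) o => .call f o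
  | .sub₁, _ => .bot
  | .sub₂, .call (.cons _ g) o => .call g o
  | .sub₂, .call (.comp f g) o => .call f (o.bind (evalPart g))
  | .sub₂, .call (.case _ g) o => .call g (o.bind predHead)
  | .sub₂, .call (.fix f) o => .call (.fix f) ((o.bind (evalPart f)).map List.tail)
  | .sub₂, _ => .bot
  | .arg, .call _ o => ofPart o
  | .arg, _ => .bot
  | .res, .call c o => ofPart (o.bind (evalPart c))
  | .res, _ => .bot
  | .new, .call (.case _ _) o => .list (total (o.bind predHead))
  | .new, .call c o => .list (total (o.bind (evalPart c)))
  | .new, _ => .list []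

def pred : Lab → Elem.{u} → Prop
  | .zero, x => x = .num 0
  | .pos, x => x ≠ .num 0
  | .dfn, x => x ≠ .bot
  | .isZero, x => x = .code (codeNum .zero')
  | .isSucc, x => x = .code (codeNum .succ)
  | .isTail, x => x = .code (codeNum .tail)
  | .isCons, x => ∃ f g, x = .code (codeNum (.cons f g))
  | .isComp, x => ∃ f g, x = .code (codeNum (.comp f g))
  | .isCase, x => ∃ f g, x = .code (codeNum (.case f g))
  | .isFix, x => ∃ f, x = .code (codeNum (.fix f))

/-- The output is `bot`. Every odd number from `5` on gets its own `code j`, whether or not `j`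
numbers a program, which makes the map injective on all of `ℕ`. -/
def const (c : Code) (n : ℕ) : ℕ → Elem.{u}
  | 0 => .bot
  | 1 => .list []
  | 2 => .list [n]
  | 3 => .call c (Part.some [n])
  | m + 4 => if m % 2 = 0 then .num (m / 2) else .code (m / 2)

/-- A left inverse of the interpretation of constants. -/
def toConst : Elem.{u} → ℕ
  | .bot => 0
  | .list [] => 1
  | .list _ => 2
  | .call _ _ => 3
  | .num k => 2 * k + 4
  | .code j => 2 * j + 5

theorem const_injective (c : Code) (n : ℕ) : Function.Injective (const.{u} c n) := by
  refine Function.LeftInverse.injective (g := toConst) fun m => ?_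
  rcases m with _ | _ | _ | _ | m
  · rfl
  · rfl
  · rfl
  · rfl
  · by_cases h : m % 2 = 0
    · simp only [const, if_pos h, toConst]
      omega
    · simp only [const, if_neg h, toConst]
      omega

@[simp] theorem const_zero (c : Code) (n : ℕ) : const.{u} c n 0 = .bot := rfl

@[simp] theorem const_one (c : Code) (n : ℕ) : const.{u} c n 1 = .list [] := rfl

@[simp] theorem const_two (c : Code) (n : ℕ) : const.{u} c n 2 = .list [n] := rfl

@[simp] theorem const_three (c : Code) (n : ℕ) : const.{u} c n 3 = .call c (Part.some [n]) := rfl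

@[simp] theorem const_numCst (c : Code) (n k : ℕ) : const.{u} c n (numCst k) = .num k := by
  simp [const, numCst]

@[simp] theorem const_codeCst (c : Code) (n : ℕ) (d : Code) :
    const.{u} c n (codeCst d) = .code (codeNum d) := by
  have h : codeCst d = 2 * codeNum d + 1 + 4 := by simp [codeCst]
  rw [h, const, if_neg (by omega)]
  congr 1
  omega

/-- The standard algebra. -/
noncomputable def algebra (c : Code) (n : ℕ) : UnaryAlgebra.{u} Op Lab where
  Carrier := Elem.{u}
  fn := fn
  pred := pred
  cst := const c n

theorem code_fn {x : Elem.{u}} {c : Code} (h : fn .code x = .code (codeNum c)) :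
    ∃ o, x = .call c o := by
  cases x <;> simp only [fn, reduceCtorEq] at h
  exact ⟨_, by rw [codeNum_injective (Elem.code.inj h)]⟩

theorem exists_of_ofPart_ne {o : Part (List ℕ)} (h : ofPart.{u} o ≠ .bot) :
    ∃ v, o = Part.some v := by
  induction o using Part.induction_on with
  | hnone => simp at h
  | hsome v => exact ⟨v, rfl⟩

theorem evalLaws (c : Code) (n : ℕ) : EvalLaws (algebra.{u} c n) := by
  constructor <;> simp only [algebra]
  · rintro (_ | _ | _ | _ | _) <;> simp [fn]
  · rintro (_ | _ | _ | _ | ⟨_ | _ | _ | _ | _ | _ | _, _⟩) <;> simp [fn, leftPart]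
  · rintro (_ | _ | _ | _ | ⟨_ | _ | _ | _ | _ | _ | _, _⟩) <;> simp [fn, rightPart]
  case zero_res | zero_hd | zero_tl =>
    intro x hk hd
    obtain ⟨o, rfl⟩ := code_fn hk
    obtain ⟨v, rfl⟩ := exists_of_ofPart_ne hd
    simp [fn, constPart]
  case succ_res | succ_hd | succ_tl =>
    intro x hk hd
    obtain ⟨o, rfl⟩ := code_fn hk
    obtain ⟨v, rfl⟩ := exists_of_ofPart_ne hd
    simp [fn, constPart]
  case tail_res =>
    intro x hk hd
    obtain ⟨o, rfl⟩ := code_fn hk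
    obtain ⟨v, rfl⟩ := exists_of_ofPart_ne hd
    simp [fn]
  case cons_arg₁ | cons_arg₂ =>
    rintro x ⟨f, g, hk⟩
    obtain ⟨o, rfl⟩ := code_fn hk
    simp [fn]
  case cons_res | cons_hd | cons_tl =>
    rintro x ⟨f, g, hk⟩ h₁ h₂
    obtain ⟨o, rfl⟩ := code_fn hk
    obtain ⟨w₁, h₁⟩ := exists_of_ofPart_ne h₁
    obtain ⟨w₂, h₂⟩ := exists_of_ofPart_ne h₂
    -- A defined result of the first subcall forces the argument `o` to be defined.
    have hr : o.bind (evalPart (.cons f g)) = Part.some (w₁.headI :: w₂) := by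
      obtain ⟨v, hv, hw₁⟩ := Part.mem_bind_iff.1 (Part.eq_some_iff.1 h₁)
      obtain rfl := Part.eq_some_iff.2 hv
      rw [Part.bind_some] at h₁ h₂ ⊢
      simp [evalPart_cons, h₁, h₂]
    simp [fn, h₁, h₂, hr]
  case comp_arg₁ | comp_arg₂ | comp_res =>
    rintro x ⟨f, g, hk⟩
    obtain ⟨o, rfl⟩ := code_fn hk
    simp [fn, evalPart_comp, Part.bind_assoc]
  case case_arg₁ =>
    rintro x ⟨f, g, hk⟩ hd
    obtain ⟨o, rfl⟩ := code_fn hk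
    obtain ⟨v, rfl⟩ := exists_of_ofPart_ne hd
    simp [fn]
  case case_res_zero =>
    rintro x ⟨f, g, hk⟩ hd hz
    obtain ⟨o, rfl⟩ := code_fn hk
    obtain ⟨v, rfl⟩ := exists_of_ofPart_ne hd
    have hz : v.headI = 0 := by simpa [fn, pred] using hz
    simp [fn, evalPart_case_zero hz]
  case case_arg₂ | case_hd | case_tl | case_res_pos =>
    rintro x ⟨f, g, hk⟩ hd hz
    obtain ⟨o, rfl⟩ := code_fn hk
    obtain ⟨v, rfl⟩ := exists_of_ofPart_ne hd
    have hz : v.headI ≠ 0 := by simpa [fn, pred] using hz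
    obtain ⟨y, hy⟩ := Nat.exists_eq_succ_of_ne_zero hz
    simp [fn, hy, predHead, evalPart_case_succ hy]
  case fix_arg₁ =>
    rintro x ⟨f, hk⟩
    obtain ⟨o, rfl⟩ := code_fn hk
    simp [fn]
  case fix_res_zero | fix_arg₂ | fix_res_pos =>
    rintro x ⟨f, hk⟩ h₁ hz
    obtain ⟨o, rfl⟩ := code_fn hk
    obtain ⟨w, h₁⟩ := exists_of_ofPart_ne h₁
    obtain ⟨v, hv, hw⟩ := Part.mem_bind_iff.1 (Part.eq_some_iff.1 h₁)
    obtain rfl := Part.eq_some_iff.2 hv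
    rw [Part.bind_some] at h₁
    simp only [fn, pred, Part.bind_some, h₁, ofPart_some, Part.map_some, Elem.num.injEq, ne_eq] at hz ⊢
    try simp [evalPart_fix h₁, hz]

theorem codeFacts_hold (c : Code) (n : ℕ) (d : Code) :
    ∀ φ ∈ codeFacts d, φ.Holds (algebra.{u} c n) := by
  induction d with
  | zero' | succ | tail =>
    simp [codeFacts, Fact.Holds, algebra, pred, fn, constPart]
    try rfl
  | cons f g hf hg | comp f g hf hg | case f g hf hg =>
    simp only [codeFacts, List.forall_mem_cons, List.forall_mem_append]
    refine ⟨⟨f, g, const_codeCst c n _⟩, ?_, ?_, hf, hg⟩ <;>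
      simp [Fact.Holds, algebra, fn, leftPart, rightPart]
  | fix f hf =>
    simp only [codeFacts, List.forall_mem_cons]
    refine ⟨⟨f, const_codeCst c n _⟩, ?_, ?_, hf⟩ <;>
      simp [Fact.Holds, algebra, fn, leftPart, rightPart]

/-- The standard algebra of a diverging program satisfies the specification of its run. -/
theorem sat_algebra {c : Code} {n : ℕ} (h : c.eval [n] = Part.none) :
    (evalSpec c n).Sat (algebra.{u} c n) where
  rules := evalLaws_iff.2 (evalLaws c n)
  labels := by
    simp only [evalSpec, List.forall_mem_cons]
    refine ⟨?_, ?_, ?_, by simp⟩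
    · rintro (_ | _ | _ | _ | _) <;> simp [algebra, fn, pred]
    · rintro (_ | _ | _ | _ | _) <;> simp [algebra, fn, pred]
    · rintro (_ | _ | _ | _ | ⟨_ | _ | _ | _ | _ | _ | _, _⟩) <;> simp [algebra, fn, pred]
  facts := by
    simp only [evalSpec, List.forall_mem_append]
    refine ⟨⟨codeFacts_hold c n c, ?_⟩, ?_⟩
    -- Divergence makes the result of the initial call `bot`, which is the output constant and its
    -- own head.
    · have h' : evalPart c [n] = Part.none := h
      simp [baseFacts, Fact.Holds, algebra, fn, pred, h']
    · simp [inputFacts, Fact.Holds, algebra, fn]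
  inj := (const_injective c n).injOn

end Elem

/-- A run ending in `[0]` leaves no algebra and hence no countermodel; a diverging run has the
standard algebra, whose carrier exists in every universe. -/
theorem entails_iff {c : Code} {n : ℕ} (h : [0] ∈ c.eval [n] ∨ c.eval [n] = Part.none) :
    (evalSpec c n).ontology.Entails.{u} (evalSpec c n).query ↔ (c.eval [n]).Dom := by
  have : Nonempty Op := ⟨suc⟩
  constructor
  · intro hent
    rcases h with h | h
    · exact Part.dom_iff_mem.2 ⟨_, h⟩
    · have hA := Elem.sat_algebra.{u} h
      exact (UnaryAlgebra.not_query hA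
        (hent _ (UnaryAlgebra.isModel hA (Elem.const_injective c n)))).elim
  · intro hdom I hI
    by_contra hψ
    obtain ⟨A, hA⟩ := (evalSpec c n).exists_sat lhs_ne_nil_of_mem_evalRules hI hψ
    rcases h with h | h
    · exact UnaryAlgebra.not_sat_of_eval h hA
    · rw [h] at hdom
      exact hdom

/-! ### The reduction of the halting problem -/

theorem primrec_role (P : ℕ) {α : Type*} [Primcodable α] {f g : α → ℕ} (hf : Primrec f)
    (hg : Primrec g) : Primrec fun a => Assertion.role P (f a) (g a) :=
  (Primrec.of_equiv_symm (e := Assertion.equiv)).comp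
    (Primrec.sumInr.comp ((Primrec.const P).pair (hf.pair hg)))

theorem primrec_concept (A : ℕ) {α : Type*} [Primcodable α] {f : α → ℕ} (hf : Primrec f) :
    Primrec fun a => Assertion.concept A (f a) :=
  (Primrec.of_equiv_symm (e := Assertion.equiv)).comp
    (Primrec.sumInl.comp ((Primrec.const A).pair hf))

theorem primrec_app (f : Op) {α : Type*} [Primcodable α] {a b : α → ℕ} (ha : Primrec a)
    (hb : Primrec b) :
    Primrec fun x => (Fact.app f (a x) (b x) : Fact Op Lab).toAssertions := by
  have h : ∀ {c : α → ℕ}, Primrec c → Primrec fun x => (Name.alg (c x)).code := fun hc =>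
    Primrec.nat_mul.comp (Primrec.const 2) hc
  exact Primrec.list_cons.comp (primrec_concept 0 (h ha))
    (Primrec.list_cons.comp (primrec_role (fnName f) (h ha) (h hb)) (Primrec.const []))

theorem primrec_numCst : Primrec numCst :=
  Primrec.nat_add.comp (Primrec.nat_mul.comp (Primrec.const 2) Primrec.id) (Primrec.const 4)

/-- Only the input facts vary with `n`. The rest is a constant, so its noncomputable enumeration of
symbols does not matter. -/
theorem primrec_ontology (c : Code) : Primrec fun n => (evalSpec c n).ontology := by
  have hinput : Primrec fun n => (inputFacts n).flatMap Fact.toAssertions := by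
    have h : ∀ n, (inputFacts n).flatMap Fact.toAssertions =
        (Fact.app hd 2 (numCst n) : Fact Op Lab).toAssertions ++ (List.range n).flatMap fun k =>
          (Fact.app suc (numCst k) (numCst (k + 1)) : Fact Op Lab).toAssertions := fun n => by
      simp [inputFacts, List.flatMap_map]
    simp only [h]
    refine Primrec.list_append.comp (primrec_app hd (Primrec.const 2) primrec_numCst)
      (Primrec.list_flatMap Primrec.list_range ?_)
    exact (primrec_app suc (primrec_numCst.comp Primrec.snd)
      (primrec_numCst.comp (Primrec.succ.comp Primrec.snd))).to₂
  have h : ∀ n, (evalSpec c n).ontology = Ontology.equiv.symm ((evalSpec c 0).tbox,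
      (auxAssertions Op Lab (evalSpec c 0).allRules.length ++
        (codeFacts c ++ baseFacts c).flatMap Fact.toAssertions) ++
        (inputFacts n).flatMap Fact.toAssertions) := fun n => by
    rw [List.append_assoc, ← List.flatMap_append]
    rfl
  simp only [h]
  exact (Primrec.of_equiv_symm (e := Ontology.equiv)).comp
    ((Primrec.const _).pair (Primrec.list_append.comp (Primrec.const _) hinput))

/-- A program that halts on `[n]` if and only if the `n`-th partial recursive function halts on `0`;
its only output is `[0]`. -/
theorem exists_universal_code : ∃ U : Code, ∀ n : ℕ,
    U.eval [n] = (Nat.Partrec.Code.eval (Denumerable.ofNat Nat.Partrec.Code n) 0).map fun _ => [0] := by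
  have h : Partrec fun n : ℕ =>
      (Nat.Partrec.Code.eval (Denumerable.ofNat Nat.Partrec.Code n) 0).map fun _ => 0 :=
    Partrec.map (Nat.Partrec.Code.eval_part.comp (Computable.ofNat Nat.Partrec.Code)
      (Computable.const 0)) (Computable.const 0).to₂
  obtain ⟨U, hU⟩ := Code.exists_code (Nat.Partrec'.part_iff₁.2 h)
  refine ⟨U, fun n => ?_⟩
  have := hU (n ::ᵥ List.Vector.nil)
  simp only [List.Vector.head_cons, Part.map_eq_map, Part.map_map] at this
  exact this

end DLLite

/-- There is no algorithm that, given a DL-Lite_core ontology `O` and a Boolean conjunctive query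
with inequalities `ψ`, decides whether `O` entails `ψ` under the Unique Name Assumption. -/
theorem theorem1 :
    ¬ ComputablePred fun p : DLLite.Ontology × DLLite.BCQ =>
      DLLite.Ontology.Entails.{u} p.1 p.2 := by
  intro h
  obtain ⟨U, hU⟩ := DLLite.exists_universal_code
  refine ComputablePred.halting_problem 0 (ComputablePred.computable_of_manyOneReducible
    ⟨fun c => ((DLLite.evalSpec U (Encodable.encode c)).ontology,
      (DLLite.evalSpec U (Encodable.encode c)).query), ?_, fun c => ?_⟩ h)
  · exact ((DLLite.primrec_ontology U).comp Primrec.encode).to_comp.pair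
      -- The query depends only on the rules, hence not on the input.
      (Computable.const (DLLite.evalSpec U 0).query)
  · have hc := hU (Encodable.encode c)
    rw [Denumerable.ofNat_encode] at hc
    refine (Iff.trans (DLLite.entails_iff ?_) (by rw [hc]; rfl)).symm
    rw [hc]
    induction Nat.Partrec.Code.eval c 0 using Part.induction_on with
    | hnone => exact .inr (by simp)
    | hsome a => exact .inl (by simp)
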